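/- Let $n\ge 2$, let $\Omega\subset\mathbb{R}^n$ be open and bounded, and let $1<p\le q\le n$. Let $\varphi:\Omega\times[0,\infty)\to[0,\infty]$ be a convex $\Phi$-function: $x\mapsto\varphi(x,s)$ is measurable for every $s\ge 0$; for a.e. $x\in\Omega$ the function $s\mapsto\varphi(x,s)$ is non-decreasing, convex and left-continuous for $s>0$, with $\varphi(x,0)=\lim_{s\to0^+}\varphi(x,s)=0$ and $\lim_{s\to\infty}\varphi(x,s)=\infty$; and for some $L\ge1$ and a.e. $x\in\Omega$, $\varphi(x,s)/s\le L\,\varphi(x,t)/t$ for all $0<s\le t$. For a set $B$ put $\varphi_B^+(s)=\sup_{x\in B\cap\Omega}\varphi(x,s)$, $\varphi_B^-(s)=\inf_{x\in B\cap\Omega}\varphi(x,s)$ and $(\varphi_B^-)^{-1}(\tau)=\inf\{s\ge0:\varphi_B^-(s)\ge\tau\}$ (with $\inf\emptyset=\infty$). Assume: - (A0) there is $\beta\in(0,1)$ with $\varphi^+_\Omega(\beta)\le1\le\varphi^-_\Omega(1/\beta)$; - (A1) there is $\beta\in(0,1)$ such that $\varphi_B^+(\beta s)\le\varphi_B^-(s)$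 for every ball $B\subset\mathbb{R}^n$ with $(\varphi_B^-)^{-1}(1/|B|)\ge1$ and every finite $s\in[1,(\varphi_B^-)^{-1}(1/|B|)]$; - (aInc)$_p$ there is $L_p\ge1$ such that, for a.e. $x\in\Omega$, $\varphi(x,s)/s^p\le L_p\,\varphi(x,t)/t^p$ for all $0<s\le t$; - (aDec)$_q$ there is $L_q\ge1$ such that, for a.e. $x\in\Omega$, $\varphi(x,t)/t^q\le L_q\,\varphi(x,s)/s^q$ for all $0<s\le t$. Let $A:\Omega\times\mathbb{R}^n\to\mathbb{R}^n$ be a Carathéodory function ($A(\cdot,z)$ is measurable for every $z$, and $A(x,\cdot)$ is continuous for a.e. $x$) such that, for some constants $c_1,c_2>0$ and a.e. $x\in\Omega$, $$|A(x,z)|\le c_1\frac{\varphi(x,|z|)}{|z|},\qquad c_2\,\varphi(x,|z|)\le A(x,z)\cdot z\qquad\text{for all }z\ne0,$$ $$0<(A(x,z_1)-A(x,z_2))\cdot(z_1-z_2)\qquad\text{for all }z_1\ne z_2.$$ For an open set $U\subset\Omega$, let $W^{1,\varphi(\cdot)}(U)$ be the set of $w\in W^{1,1}(U)$ with $\int_U\varphi(x,|w|)\,dx<\infty$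 and $\int_U\varphi(x,|Dw|)\,dx<\infty$, where $Dw$ is the weak gradient, with the norm $\|w\|_{L^{\varphi(\cdot)}(U)}+\|Dw\|_{L^{\varphi(\cdot)}(U)}$, where $\|f\|_{L^{\varphi(\cdot)}(U)}=\inf\{\lambda>0:\int_U\varphi(x,|f|/\lambda)\,dx\le1\}$. Let $W^{1,\varphi(\cdot)}_0(U)$ be the closure of $C_c^\infty(U)$ in $W^{1,\varphi(\cdot)}(U)$. For an open ball $B$ of radius $\varrho(B)>0$ let $h_{\varphi(\cdot)}(B)=\int_B\varphi(x,1/\varrho(B))\,dx$, and for $E\subset\Omega$ let $$\mathcal{H}_{\varphi(\cdot)}(E)=\sup_{\delta>0}\ \inf\sum_j h_{\varphi(\cdot)}(B_j),$$ the infimum being taken over all countable (possibly finite) collections of open balls $B_j\subset\Omega$ with $\varrho(B_j)\le\delta$ that cover $E$. Let $E\subset\Omega$ be relatively closed in $\Omega$ with $\mathcal{H}_{\varphi(\cdot)}(E)<\infty$, and let $u\in W^{1,\varphi(\cdot)}(\Omega)$ satisfy $$\int_{\Omega\setminus E}A(x,Du)\cdot Dw\,dx=0\qquad\text{for all }w\in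 W_0^{1,\varphi(\cdot)}(\Omega\setminus E).$$ Then $u$ is a solution of $-\operatorname{div}A(x,Du)=0$ in all of $\Omega$; that is, for every $w\in W_0^{1,\varphi(\cdot)}(\Omega)$ the function $A(x,Du)\cdot Dw$ is integrable on $\Omega$ and $$\int_{\Omega}A(x,Du)\cdot Dw\,dx=0.$$ -/

import Mathlib

open MeasureTheory Filter Topology
open scoped NNReal ENNReal ContDiff RealInnerProductSpace

namespace MusielakOrlicz

/-- The Euclidean space `ℝⁿ`. -/
abbrev Euc (n : ℕ) := EuclideanSpace ℝ (Fin n)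

variable {n : ℕ}

/-! Generalized Orlicz functions `φ : Ω × [0, ∞) → [0, ∞]`.  Values outside `Ω` never matter. -/

/-- `φ` is a convex `Φ`-function on `Ω`. -/
structure IsConvexPhi (Ω : Set (Euc n)) (φ : Euc n → ℝ≥0 → ℝ≥0∞) : Prop where
  measurable : ∀ s : ℝ≥0, AEMeasurable (fun x => φ x s) (volume.restrict Ω)
  monotone : ∀ᵐ x ∂volume.restrict Ω, Monotone (φ x)
  convex : ∀ᵐ x ∂volume.restrict Ω, ConvexOn ℝ≥0 Set.univ (φ x)
  left_continuous : ∀ᵐ x ∂volume.restrict Ω, ∀ s : ℝ≥0, 0 < s →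
    ContinuousWithinAt (φ x) (Set.Iic s) s
  zero : ∀ᵐ x ∂volume.restrict Ω, φ x 0 = 0
  tendsto_zero : ∀ᵐ x ∂volume.restrict Ω, Tendsto (φ x) (𝓝[>] 0) (𝓝 0)
  tendsto_top : ∀ᵐ x ∂volume.restrict Ω, Tendsto (φ x) atTop (𝓝 ⊤)
  almost_increasing : ∃ L : ℝ≥0, 1 ≤ L ∧ ∀ᵐ x ∂volume.restrict Ω, ∀ s t : ℝ≥0, 0 < s → s ≤ t →
    φ x s / s ≤ L * (φ x t / t)

/-- `φ⁺_B(s)`, the supremum of `φ(x, s)` over `x ∈ B ∩ Ω`. -/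
noncomputable def phiPlus (Ω : Set (Euc n)) (φ : Euc n → ℝ≥0 → ℝ≥0∞) (B : Set (Euc n))
    (s : ℝ≥0) : ℝ≥0∞ :=
  ⨆ x ∈ B ∩ Ω, φ x s

/-- `φ⁻_B(s)`, the infimum of `φ(x, s)` over `x ∈ B ∩ Ω`. -/
noncomputable def phiMinus (Ω : Set (Euc n)) (φ : Euc n → ℝ≥0 → ℝ≥0∞) (B : Set (Euc n))
    (s : ℝ≥0) : ℝ≥0∞ :=
  ⨅ x ∈ B ∩ Ω, φ x s

/-- The generalized inverse `f⁻¹(τ) = inf {s ≥ 0 : f(s) ≥ τ}` (with `inf ∅ = ∞`). -/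
noncomputable def genInv (f : ℝ≥0 → ℝ≥0∞) (τ : ℝ≥0∞) : ℝ≥0∞ :=
  ⨅ (s : ℝ≥0) (_ : τ ≤ f s), (s : ℝ≥0∞)

/-- Condition (A0). -/
def CondA0 (Ω : Set (Euc n)) (φ : Euc n → ℝ≥0 → ℝ≥0∞) : Prop :=
  ∃ β : ℝ≥0, 0 < β ∧ β < 1 ∧
    phiPlus Ω φ Set.univ β ≤ 1 ∧ 1 ≤ phiMinus Ω φ Set.univ β⁻¹

/-- Condition (A1). -/
def CondA1 (Ω : Set (Euc n)) (φ : Euc n → ℝ≥0 → ℝ≥0∞) : Prop :=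
  ∃ β : ℝ≥0, 0 < β ∧ β < 1 ∧ ∀ (x₀ : Euc n) (r : ℝ), 0 < r →
    1 ≤ genInv (phiMinus Ω φ (Metric.ball x₀ r)) (volume (Metric.ball x₀ r))⁻¹ →
    ∀ s : ℝ≥0, 1 ≤ s →
      (s : ℝ≥0∞) ≤ genInv (phiMinus Ω φ (Metric.ball x₀ r)) (volume (Metric.ball x₀ r))⁻¹ →
      phiPlus Ω φ (Metric.ball x₀ r) (β * s) ≤ phiMinus Ω φ (Metric.ball x₀ r) s

/-- Condition (aInc)_p: `s ↦ φ(x, s) / s ^ p` is almost increasing on `(0, ∞)`. -/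
def CondAInc (Ω : Set (Euc n)) (φ : Euc n → ℝ≥0 → ℝ≥0∞) (p : ℝ) : Prop :=
  ∃ L : ℝ≥0, 1 ≤ L ∧ ∀ᵐ x ∂volume.restrict Ω, ∀ s t : ℝ≥0, 0 < s → s ≤ t →
    φ x s / (s : ℝ≥0∞) ^ p ≤ L * (φ x t / (t : ℝ≥0∞) ^ p)

/-- Condition (aDec)_q: `s ↦ φ(x, s) / s ^ q` is almost decreasing on `(0, ∞)`. -/
def CondADec (Ω : Set (Euc n)) (φ : Euc n → ℝ≥0 → ℝ≥0∞) (q : ℝ) : Prop :=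
  ∃ L : ℝ≥0, 1 ≤ L ∧ ∀ᵐ x ∂volume.restrict Ω, ∀ s t : ℝ≥0, 0 < s → s ≤ t →
    φ x t / (t : ℝ≥0∞) ^ q ≤ L * (φ x s / (s : ℝ≥0∞) ^ q)

/-! The operator. -/

/-- Structure conditions on the vector field `A`: Carathéodory, `φ`-growth, `φ`-coercivity with
some positive constants, and strict monotonicity. -/
structure IsAdmissibleField (Ω : Set (Euc n)) (φ : Euc n → ℝ≥0 → ℝ≥0∞)
    (A : Euc n → Euc n → Euc n) : Prop where
  measurable : ∀ z : Euc n, AEMeasurable (fun x => A x z) (volume.restrict Ω)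
  continuous : ∀ᵐ x ∂volume.restrict Ω, Continuous (A x)
  growth : ∃ c₁ : ℝ≥0, 0 < c₁ ∧ ∀ᵐ x ∂volume.restrict Ω, ∀ z : Euc n, z ≠ 0 →
    ‖A x z‖ₑ ≤ c₁ * φ x ‖z‖₊ / ‖z‖ₑ
  coercive : ∃ c₂ : ℝ≥0, 0 < c₂ ∧ ∀ᵐ x ∂volume.restrict Ω, ∀ z : Euc n, z ≠ 0 →
    c₂ * φ x ‖z‖₊ ≤ ENNReal.ofReal ⟪A x z, z⟫
  strict_mono : ∀ᵐ x ∂volume.restrict Ω, ∀ z₁ z₂ : Euc n, z₁ ≠ z₂ →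
    0 < ⟪A x z₁ - A x z₂, z₁ - z₂⟫

/-! Function spaces.  Below `U` is an open set; functions are defined on the whole of `ℝⁿ`, but
only their restrictions to `U` matter. -/

/-- The modular `∫_U φ(x, |f|) dx`, for scalar or vector valued `f`. -/
noncomputable def modular {F : Type*} [NormedAddCommGroup F] (φ : Euc n → ℝ≥0 → ℝ≥0∞)
    (U : Set (Euc n)) (f : Euc n → F) : ℝ≥0∞ :=
  ∫⁻ x in U, φ x ‖f x‖₊

/-- The Luxemburg norm `inf {t > 0 : ∫_U φ(x, |f| / t) dx ≤ 1}`. -/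
noncomputable def luxNorm {F : Type*} [NormedAddCommGroup F] (φ : Euc n → ℝ≥0 → ℝ≥0∞)
    (U : Set (Euc n)) (f : Euc n → F) : ℝ≥0∞ :=
  ⨅ (t : ℝ≥0) (_ : 0 < t ∧ ∫⁻ x in U, φ x (‖f x‖₊ / t) ≤ 1), (t : ℝ≥0∞)

/-- `ψ ∈ C_c^∞(U)`. -/
structure IsTestFunction (U : Set (Euc n)) (ψ : Euc n → ℝ) : Prop where
  smooth : ContDiff ℝ ∞ ψ
  compact_support : HasCompactSupport ψ
  support_subset : tsupport ψ ⊆ U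

/-- `g` is a weak (distributional) gradient of `u` in `U`. -/
structure HasWeakGradient (U : Set (Euc n)) (u : Euc n → ℝ) (g : Euc n → Euc n) : Prop where
  locallyIntegrable : LocallyIntegrableOn u U
  locallyIntegrable_grad : LocallyIntegrableOn g U
  integral_eq : ∀ ψ : Euc n → ℝ, IsTestFunction U ψ →
    ∫ x in U, u x • gradient ψ x = -∫ x in U, ψ x • g x

/-- `u ∈ W^{1,φ(·)}(U)`: `u ∈ W^{1,1}(U)`, and `u` and `|Du|` belong to `L^{φ(·)}(U)`. -/
def MemW1 (φ : Euc n → ℝ≥0 → ℝ≥0∞) (U : Set (Euc n)) (u : Euc n → ℝ) : Prop :=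
  ∃ Du : Euc n → Euc n, HasWeakGradient U u Du ∧ IntegrableOn u U ∧ IntegrableOn Du U ∧
    modular φ U u < ⊤ ∧ modular φ U Du < ⊤

/-- `w ∈ W_0^{1,φ(·)}(U)`: `w` lies in the closure of `C_c^∞(U)` in `W^{1,φ(·)}(U)`, with respect
to the norm `‖w‖_{L^{φ(·)}(U)} + ‖Dw‖_{L^{φ(·)}(U)}`. -/
def MemW10 (φ : Euc n → ℝ≥0 → ℝ≥0∞) (U : Set (Euc n)) (w : Euc n → ℝ) : Prop :=
  MemW1 φ U w ∧ ∃ Dw : Euc n → Euc n, HasWeakGradient U w Dw ∧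
    ∀ ε : ℝ≥0∞, 0 < ε → ∃ ψ : Euc n → ℝ, IsTestFunction U ψ ∧
      luxNorm φ U (fun x => w x - ψ x) + luxNorm φ U (fun x => Dw x - gradient ψ x) < ε

/-- `u` is a (weak) solution of `-div A(x, Du) = 0` in `Ω`: `u ∈ W^{1,φ(·)}(Ω)` and
`∫_Ω A(x, Du) · Dw dx = 0`, the integral being absolutely convergent, for every
`w ∈ W_0^{1,φ(·)}(Ω)`.  (Weak gradients are unique up to null sets, so the choice of
`Du` and `Dw` is immaterial.) -/
def IsSolution (φ : Euc n → ℝ≥0 → ℝ≥0∞) (A : Euc n → Euc n → Euc n) (Ω : Set (Euc n))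
    (u : Euc n → ℝ) : Prop :=
  MemW1 φ Ω u ∧ ∀ Du : Euc n → Euc n, HasWeakGradient Ω u Du →
    ∀ (w : Euc n → ℝ) (Dw : Euc n → Euc n), MemW10 φ Ω w → HasWeakGradient Ω w Dw →
      IntegrableOn (fun x => ⟪A x (Du x), Dw x⟫) Ω ∧ ∫ x in Ω, ⟪A x (Du x), Dw x⟫ = 0

/-! The intrinsic Hausdorff measure.  A ball is given by its centre and its radius. -/

/-- `h_{φ(·)}(B) = ∫_B φ(x, 1/ρ) dx` for the open ball `B` of centre `b.1` and radius
`ρ = b.2`. -/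
noncomputable def hBall (φ : Euc n → ℝ≥0 → ℝ≥0∞) (b : Euc n × ℝ≥0) : ℝ≥0∞ :=
  ∫⁻ x in Metric.ball b.1 b.2, φ x (b.2)⁻¹

/-- `C` is a countable (possibly finite) collection of open balls contained in `Ω`, of radius at
most `δ`, covering `E`. -/
structure IsBallCover (Ω E : Set (Euc n)) (δ : ℝ≥0) (C : Set (Euc n × ℝ≥0)) : Prop where
  countable : C.Countable
  radius_pos : ∀ b ∈ C, 0 < b.2
  radius_le : ∀ b ∈ C, b.2 ≤ δ
  subset : ∀ b ∈ C, Metric.ball b.1 (b.2 : ℝ) ⊆ Ω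
  covers : E ⊆ ⋃ b ∈ C, Metric.ball b.1 (b.2 : ℝ)

/-- The approximating measure `H_{φ(·),δ}(E)`. -/
noncomputable def hausdorffDelta (φ : Euc n → ℝ≥0 → ℝ≥0∞) (Ω : Set (Euc n)) (δ : ℝ≥0)
    (E : Set (Euc n)) : ℝ≥0∞ :=
  ⨅ (C : Set (Euc n × ℝ≥0)) (_ : IsBallCover Ω E δ C), ∑' b : C, hBall φ b

/-- The intrinsic Hausdorff measure `H_{φ(·)}(E) = sup_{δ > 0} H_{φ(·),δ}(E)`. -/
noncomputable def hausdorffPhi (φ : Euc n → ℝ≥0 → ℝ≥0∞) (Ω : Set (Euc n))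
    (E : Set (Euc n)) : ℝ≥0∞ :=
  ⨆ (δ : ℝ≥0) (_ : 0 < δ), hausdorffDelta φ Ω δ E

end MusielakOrlicz

namespace MusielakOrlicz

variable {n : ℕ}

section

/-! ### Pointwise consequences of the structural conditions -/

variable {Ω : Set (Euc n)} {φ : Euc n → ℝ≥0 → ℝ≥0∞}

/-! Write f = A(x, Du). By density it suffices to show ∫ f · Dψ = 0 for test functions ψ of Ω.
Growth of A and (aInc)_p give a Young inequality with a free parameter K ≥ 1: |f||ζ| ≤ cK φ(x,|Du|)
+ L K^(1-p) φ(x,|ζ|) (`IsAdmissibleField.young`).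

Cover the compact set E ∩ supp ψ by finitely many small balls of a cover whose total gauge is at
most M. Let w be a cutoff equal to 1 on these balls, with |Dw| ≲ 1/ρ on the tripled balls, and put v
= (1-w)ψ. Then v is a test function of Ω \ E, and Dψ - Dv lives in an r-neighbourhood of E ∩ supp ψ.
Its modular is bounded independently of r (`exists_isTestFunction_diff`): the gauge of a tripled
ball is controlled by that of the ball (`exists_lintegral_dilate_le`, where (A1) and q ≤ n enter),
and a log-sum-exp cutoff makes |Dw| as small as for a maximum of bumps (`exists_smooth_max`).

Finite Hausdorff measure forces |E| = 0 (`volume_eq_zero_of_hausdorffPhi_lt_top`). Hence |∫ f · Dψ|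
= |∫ f · (Dψ - Dv)| is at most cK times the integral of φ(x,|Du|) over a neighbourhood shrinking to
a null set, plus C K^(1-p). The modular of Dψ - Dv need not tend to 0; letting r → 0 and then K → ∞,
with p > 1, is what removes it. -/

theorem coe_div_rpow_eq (a : ℝ≥0∞) {s : ℝ≥0} (hs : s ≠ 0) (q : ℝ) :
    a / (s : ℝ≥0∞) ^ q = a / ((s ^ q : ℝ≥0) : ℝ≥0∞) := by
  rw [ENNReal.coe_rpow_of_ne_zero hs]

/-- A quotient-free form, easier to use in [0, ∞]. At s = 0, where (aDec) says nothing, φ(x, 0) = 0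
fills the gap. -/
theorem CondADec.le_mul {q : ℝ} (hφ : IsConvexPhi Ω φ) (h : CondADec Ω φ q) :
    ∃ L : ℝ≥0, 1 ≤ L ∧ ∀ᵐ x ∂volume.restrict Ω, ∀ k s : ℝ≥0, 1 ≤ k →
      φ x (k * s) ≤ ((L * k ^ q : ℝ≥0) : ℝ≥0∞) * φ x s := by
  obtain ⟨L, hL, h⟩ := h
  refine ⟨L, hL, ?_⟩
  filter_upwards [h, hφ.zero] with x hx h0 k s hk
  rcases eq_or_ne s 0 with rfl | hs
  · simp [h0]
  have hk0 : k ≠ 0 := (zero_lt_one.trans_le hk).ne'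
  have hs' : 0 < s := pos_iff_ne_zero.2 hs
  have hq : s ^ q ≠ 0 := (NNReal.rpow_pos hs').ne'
  have hkq : (k * s) ^ q ≠ 0 := (NNReal.rpow_pos (pos_iff_ne_zero.2 (mul_ne_zero hk0 hs))).ne'
  have := hx s (k * s) hs' (le_mul_of_one_le_left hs'.le hk)
  rw [coe_div_rpow_eq _ hs, coe_div_rpow_eq _ (mul_ne_zero hk0 hs),
    ENNReal.div_le_iff (by simpa using hkq) (by simp)] at this
  refine this.trans (le_of_eq ?_)
  rw [NNReal.mul_rpow, ENNReal.coe_mul, ENNReal.coe_mul]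
  have h1 : φ x s / ((s ^ q : ℝ≥0) : ℝ≥0∞) * ((s ^ q : ℝ≥0) : ℝ≥0∞) = φ x s :=
    ENNReal.div_mul_cancel (by simpa using hq) (by simp)
  calc (L : ℝ≥0∞) * (φ x s / ((s ^ q : ℝ≥0) : ℝ≥0∞)) *
        (((k ^ q : ℝ≥0) : ℝ≥0∞) * ((s ^ q : ℝ≥0) : ℝ≥0∞))
      = L * ((k ^ q : ℝ≥0) : ℝ≥0∞) *
        (φ x s / ((s ^ q : ℝ≥0) : ℝ≥0∞) * ((s ^ q : ℝ≥0) : ℝ≥0∞)) := by ring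
    _ = _ := by rw [h1]

theorem CondAInc.mul_le {p : ℝ} (hφ : IsConvexPhi Ω φ) (h : CondAInc Ω φ p) :
    ∃ L : ℝ≥0, 1 ≤ L ∧ ∀ᵐ x ∂volume.restrict Ω, ∀ k s : ℝ≥0, 1 ≤ k →
      ((k ^ p : ℝ≥0) : ℝ≥0∞) * φ x s ≤ L * φ x (k * s) := by
  obtain ⟨L, hL, h⟩ := h
  refine ⟨L, hL, ?_⟩
  filter_upwards [h, hφ.zero] with x hx h0 k s hk
  rcases eq_or_ne s 0 with rfl | hs
  · simp [h0]
  have hk0 : k ≠ 0 := (zero_lt_one.trans_le hk).ne'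
  have hs' : 0 < s := pos_iff_ne_zero.2 hs
  have hq : s ^ p ≠ 0 := (NNReal.rpow_pos hs').ne'
  have hkq : (k * s) ^ p ≠ 0 := (NNReal.rpow_pos (pos_iff_ne_zero.2 (mul_ne_zero hk0 hs))).ne'
  have := hx s (k * s) hs' (le_mul_of_one_le_left hs'.le hk)
  rw [coe_div_rpow_eq _ hs, coe_div_rpow_eq _ (mul_ne_zero hk0 hs),
    ENNReal.div_le_iff (by simpa using hq) (by simp)] at this
  have h1 : φ x (k * s) / (((k * s) ^ p : ℝ≥0) : ℝ≥0∞) * (((k * s) ^ p : ℝ≥0) : ℝ≥0∞) =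
      φ x (k * s) := ENNReal.div_mul_cancel (by simpa using hkq) (by simp)
  calc ((k ^ p : ℝ≥0) : ℝ≥0∞) * φ x s
      ≤ ((k ^ p : ℝ≥0) : ℝ≥0∞) * (L * (φ x (k * s) / (((k * s) ^ p : ℝ≥0) : ℝ≥0∞)) *
          ((s ^ p : ℝ≥0) : ℝ≥0∞)) := by gcongr
    _ = L * (φ x (k * s) / (((k * s) ^ p : ℝ≥0) : ℝ≥0∞) *
          (((k * s) ^ p : ℝ≥0) : ℝ≥0∞)) := by
        have h2 : (((k * s) ^ p : ℝ≥0) : ℝ≥0∞) = ((k ^ p : ℝ≥0) : ℝ≥0∞) * ((s ^ p : ℝ≥0) : ℝ≥0∞) := by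
          rw [NNReal.mul_rpow, ENNReal.coe_mul]
        generalize φ x (k * s) / (((k * s) ^ p : ℝ≥0) : ℝ≥0∞) = a
        rw [h2]; ring
    _ = _ := by rw [h1]

/-- Polynomial growth: with `β` from (A0), `φ(x, kβ) ≤ L k ^ q` for `k ≥ 1`. -/
theorem ae_le_of_phiPlus_le_one {β L : ℝ≥0} {q : ℝ} (hΩ : MeasurableSet Ω)
    (hβ : phiPlus Ω φ Set.univ β ≤ 1)
    (h : ∀ᵐ x ∂volume.restrict Ω, ∀ k s : ℝ≥0, 1 ≤ k →
      φ x (k * s) ≤ ((L * k ^ q : ℝ≥0) : ℝ≥0∞) * φ x s) :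
    ∀ᵐ x ∂volume.restrict Ω, ∀ k : ℝ≥0, 1 ≤ k → φ x (k * β) ≤ ((L * k ^ q : ℝ≥0) : ℝ≥0∞) := by
  filter_upwards [h, ae_restrict_mem hΩ] with x hx hxΩ k hk
  refine (hx k β hk).trans (mul_le_of_le_one_right' ?_)
  exact (le_iSup₂ (f := fun x (_ : x ∈ Set.univ ∩ Ω) => φ x β) x ⟨trivial, hxΩ⟩).trans hβ

theorem exists_ae_le_coe {q : ℝ} (hΩ : MeasurableSet Ω) (hφ : IsConvexPhi Ω φ)
    (hA0 : CondA0 Ω φ) (hdec : CondADec Ω φ q) (s : ℝ≥0) :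
    ∃ C : ℝ≥0, ∀ᵐ x ∂volume.restrict Ω, φ x s ≤ C := by
  obtain ⟨β, hβ0, -, hβ, -⟩ := hA0
  obtain ⟨L, -, hL⟩ := hdec.le_mul hφ
  refine ⟨L * (max 1 (s / β)) ^ q, ?_⟩
  filter_upwards [ae_le_of_phiPlus_le_one hΩ hβ hL, hφ.monotone] with x hx hm
  refine (hm ?_).trans (hx _ (le_max_left _ _))
  calc s = s / β * β := (div_mul_cancel₀ _ hβ0.ne').symm
    _ ≤ _ := by gcongr; exact le_max_right _ _

/-- Young's inequality for the growth bound of `A`. -/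
theorem young_of_growth {p : ℝ} (hp : 1 < p) {f : ℝ≥0 → ℝ≥0∞} {L c : ℝ≥0}
    (hinc : ∀ k s : ℝ≥0, 1 ≤ k → ((k ^ p : ℝ≥0) : ℝ≥0∞) * f s ≤ L * f (k * s))
    {K : ℝ≥0} (hK : 1 ≤ K) {s : ℝ≥0} (hs : s ≠ 0) (t : ℝ≥0) :
    c * f s / s * t ≤ (c * K : ℝ≥0) * f s + ((c * L * (K ^ (p - 1))⁻¹ : ℝ≥0) : ℝ≥0∞) * f t := by
  have hdiv : c * f s / s * t = ((t / s : ℝ≥0) : ℝ≥0∞) * (c * f s) := by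
    rw [ENNReal.coe_div hs, ENNReal.div_eq_inv_mul, ENNReal.div_eq_inv_mul]; ring
  rw [hdiv]
  -- For t ≤ Ks the factor t/s is absorbed by K. Otherwise, with k = t/s, write k = k^(1-p) k^p: the
  -- power k^p turns f(s) into L f(t), and k^(1-p) ≤ K^(1-p).
  rcases le_total (t / s) K with h | h
  · refine le_add_of_le_of_nonneg ?_ zero_le
    calc ((t / s : ℝ≥0) : ℝ≥0∞) * (c * f s) ≤ (K : ℝ≥0∞) * (c * f s) := by gcongr
      _ = _ := by push_cast; ring
  · refine le_add_of_nonneg_of_le zero_le ?_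
    set k := t / s with hk
    have hk1 : 1 ≤ k := hK.trans h
    have hk0 : k ≠ 0 := (zero_lt_one.trans_le hk1).ne'
    have hks : k * s = t := div_mul_cancel₀ _ hs
    have h2 := hinc k s hk1
    rw [hks] at h2
    have hsplit : k = (k ^ (p - 1))⁻¹ * k ^ p := by
      rw [← NNReal.rpow_neg, ← NNReal.rpow_add hk0]; simp
    have hle : (k ^ (p - 1))⁻¹ ≤ (K ^ (p - 1))⁻¹ := by
      have : 0 < K := zero_lt_one.trans_le hK
      gcongr
    calc (k : ℝ≥0∞) * (c * f s)
        = c * (((k ^ (p - 1))⁻¹ : ℝ≥0) : ℝ≥0∞) * (((k ^ p : ℝ≥0) : ℝ≥0∞) * f s) := by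
          nth_rewrite 1 [hsplit]; rw [ENNReal.coe_mul]; ring
      _ ≤ c * (((K ^ (p - 1))⁻¹ : ℝ≥0) : ℝ≥0∞) * (L * f t) := by gcongr
      _ = _ := by push_cast; ring

/-- The growth bound is silent at z = 0. That case is a limit z → 0: A(x, ·) is continuous and φ(x,
|z|) → 0. Positive dimension makes the punctured neighbourhood nontrivial. -/
theorem IsAdmissibleField.young {A : Euc n → Euc n → Euc n} (hn : n ≠ 0)
    (hA : IsAdmissibleField Ω φ A) (hφ : IsConvexPhi Ω φ) {p : ℝ} (hp : 1 < p)
    (hinc : CondAInc Ω φ p) :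
    ∃ c L : ℝ≥0, ∀ᵐ x ∂volume.restrict Ω, ∀ K : ℝ≥0, 1 ≤ K → ∀ z ζ : Euc n,
      ‖A x z‖ₑ * ‖ζ‖ₑ ≤ (c * K : ℝ≥0) * φ x ‖z‖₊ +
        ((L * (K ^ (p - 1))⁻¹ : ℝ≥0) : ℝ≥0∞) * φ x ‖ζ‖₊ := by
  obtain ⟨c, -, hc⟩ := hA.growth
  obtain ⟨L, -, hL⟩ := hinc.mul_le hφ
  refine ⟨c, c * L, ?_⟩
  filter_upwards [hc, hL, hA.continuous, hφ.zero, hφ.tendsto_zero] with x hg hinc hcont h0 ht K hK z ζ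
  have main : ∀ z : Euc n, z ≠ 0 → ‖A x z‖ₑ * ‖ζ‖ₑ ≤ (c * K : ℝ≥0) * φ x ‖z‖₊ +
        ((c * L * (K ^ (p - 1))⁻¹ : ℝ≥0) : ℝ≥0∞) * φ x ‖ζ‖₊ := fun z hz =>
    (mul_le_mul_left (hg z hz) _).trans
      (young_of_growth hp hinc hK (nnnorm_ne_zero_iff.2 hz) ‖ζ‖₊)
  rcases eq_or_ne z 0 with rfl | hz
  swap
  · exact main z hz
  have : Nonempty (Fin n) := ⟨⟨0, Nat.pos_of_ne_zero hn⟩⟩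
  have h1 : Tendsto (fun z => ‖A x z‖ₑ * ‖ζ‖ₑ) (𝓝[≠] 0) (𝓝 (‖A x 0‖ₑ * ‖ζ‖ₑ)) := by
    refine Tendsto.mono_left ?_ nhdsWithin_le_nhds
    exact ENNReal.Tendsto.mul_const (hcont.enorm.tendsto 0) (Or.inr (by simp))
  have hnorm : Tendsto (fun z : Euc n => ‖z‖₊) (𝓝[≠] 0) (𝓝[>] 0) := by
    refine tendsto_nhdsWithin_iff.2 ⟨?_, ?_⟩
    · have : Tendsto (fun z : Euc n => ‖z‖₊) (𝓝 0) (𝓝 ‖(0 : Euc n)‖₊) := continuous_nnnorm.tendsto 0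
      rw [nnnorm_zero] at this
      exact this.mono_left nhdsWithin_le_nhds
    · filter_upwards [self_mem_nhdsWithin] with z hz
      exact pos_iff_ne_zero.2 (nnnorm_ne_zero_iff.2 hz)
  have h2 := ht.comp hnorm
  have h3 : Tendsto (fun z : Euc n => ((c * K : ℝ≥0) : ℝ≥0∞) * φ x ‖z‖₊ +
        ((c * L * (K ^ (p - 1))⁻¹ : ℝ≥0) : ℝ≥0∞) * φ x ‖ζ‖₊) (𝓝[≠] 0)
      (𝓝 (((c * K : ℝ≥0) : ℝ≥0∞) * 0 +
        ((c * L * (K ^ (p - 1))⁻¹ : ℝ≥0) : ℝ≥0∞) * φ x ‖ζ‖₊)) :=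
    (ENNReal.Tendsto.const_mul h2 (Or.inr ENNReal.coe_ne_top)).add tendsto_const_nhds
  have := le_of_tendsto_of_tendsto h1 h3 (by
    filter_upwards [self_mem_nhdsWithin] with z hz using main z hz)
  simpa [h0] using this

/-! ### Measurability of superpositions -/

theorem aemeasurable_apply_simpleFunc {X Y Z : Type*} [MeasurableSpace X] [MeasurableSpace Y]
    [MeasurableSpace Z] {μ : Measure X} {F : X → Y → Z} (hF : ∀ y, AEMeasurable (fun x => F x y) μ)
    (s : SimpleFunc X Y) : AEMeasurable (fun x => F x (s x)) μ := by
  refine ⟨fun x => (hF (s x)).mk _ x,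
    SimpleFunc.measurable_bind s (fun y => (hF y).mk _) fun y => (hF y).measurable_mk, ?_⟩
  have : ∀ᵐ x ∂μ, ∀ y ∈ s.range, F x y = (hF y).mk _ x :=
    (Finset.eventually_all s.range).2 fun y _ => (hF y).ae_eq_mk
  filter_upwards [this] with x hx using hx _ (s.mem_range_self x)

theorem aemeasurable_apply_of_continuous {X Y Z : Type*} [MeasurableSpace X]
    [PseudoEMetricSpace Y] [MeasurableSpace Y] [BorelSpace Y] [SecondCountableTopology Y] [Nonempty Y]
    [MeasurableSpace Z] [TopologicalSpace Z] [TopologicalSpace.PseudoMetrizableSpace Z] [BorelSpace Z]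
    {μ : Measure X} {F : X → Y → Z} (hF : ∀ y, AEMeasurable (fun x => F x y) μ)
    (hc : ∀ᵐ x ∂μ, Continuous (F x)) {g : X → Y} (hg : AEMeasurable g μ) :
    AEMeasurable (fun x => F x (g x)) μ := by
  have key : AEMeasurable (fun x => F x (hg.mk g x)) μ := by
    let y₀ : Y := Classical.arbitrary Y
    refine aemeasurable_of_tendsto_metrizable_ae atTop
      (f := fun k x => F x (SimpleFunc.approxOn (hg.mk g) hg.measurable_mk Set.univ y₀ trivial k x))
      (fun k => aemeasurable_apply_simpleFunc hF _) ?_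
    filter_upwards [hc] with x hx
    exact (hx.tendsto _).comp (SimpleFunc.tendsto_approxOn hg.measurable_mk (Set.mem_univ y₀) (by simp))
  refine key.congr ?_
  filter_upwards [hg.ae_eq_mk] with x hx
  rw [hx]

/-- Since φ(x, ·) is only left-continuous, the simple approximants must increase from below. Where g
= 0 they are constantly 0, so left-continuity is needed only at positive points. -/
theorem IsConvexPhi.aemeasurable_apply (hφ : IsConvexPhi Ω φ) {μ : Measure (Euc n)}
    (hμ : μ ≪ volume.restrict Ω) {g : Euc n → ℝ≥0}
    (hg : AEMeasurable g μ) : AEMeasurable (fun x => φ x (g x)) μ := by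
  have key : AEMeasurable (fun x => φ x (hg.mk g x)) μ := by
    have hm := hg.measurable_mk.coe_nnreal_ennreal
    let s : ℕ → SimpleFunc (Euc n) ℝ≥0 := fun k =>
      (SimpleFunc.eapprox (fun x => ((hg.mk g x : ℝ≥0) : ℝ≥0∞)) k).map ENNReal.toNNReal
    refine aemeasurable_of_tendsto_metrizable_ae atTop (f := fun k x => φ x (s k x))
      (fun k => aemeasurable_apply_simpleFunc (fun y => (hφ.measurable y).mono_ac hμ) _) ?_
    filter_upwards [hμ.ae_le hφ.left_continuous] with x hx
    have hlim : Tendsto (fun k => s k x) atTop (𝓝 (hg.mk g x)) := by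
      have := (ENNReal.tendsto_toNNReal (ENNReal.coe_ne_top (r := hg.mk g x))).comp
        (SimpleFunc.tendsto_eapprox hm x)
      simpa [s, Function.comp_def] using this
    have hle : ∀ k, s k x ≤ hg.mk g x := fun k => by
      have h1 : SimpleFunc.eapprox (fun x => ((hg.mk g x : ℝ≥0) : ℝ≥0∞)) k x ≤ hg.mk g x := by
        rw [← SimpleFunc.iSup_eapprox_apply hm x]
        exact le_iSup (fun k => SimpleFunc.eapprox (fun x => ((hg.mk g x : ℝ≥0) : ℝ≥0∞)) k x) k
      have := ENNReal.toNNReal_mono ENNReal.coe_ne_top h1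
      simpa [s] using this
    rcases eq_or_ne (hg.mk g x) 0 with h0 | h0
    · have : ∀ k, s k x = hg.mk g x := fun k => le_antisymm (hle k) (by simp [h0])
      simp only [this]
      exact tendsto_const_nhds
    · exact (hx _ (pos_iff_ne_zero.2 h0)).tendsto.comp
        (tendsto_nhdsWithin_iff.2 ⟨hlim, Eventually.of_forall hle⟩)
  refine key.congr ?_
  filter_upwards [hg.ae_eq_mk] with x hx
  rw [hx]

end

section

/-! ### Doubling of the gauge `h` and null sets -/

variable {Ω : Set (Euc n)} {φ : Euc n → ℝ≥0 → ℝ≥0∞}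

theorem exists_volume_ball_eq (hn : n ≠ 0) : ∃ v₁ : ℝ≥0, 0 < v₁ ∧ ∀ (x : Euc n) (r : ℝ≥0),
    volume (Metric.ball x (r : ℝ)) = ((r ^ n * v₁ : ℝ≥0) : ℝ≥0∞) := by
  have : Nonempty (Fin n) := ⟨⟨0, Nat.pos_of_ne_zero hn⟩⟩
  have hfin : volume (Metric.ball (0 : Euc n) 1) ≠ ⊤ := measure_ball_lt_top.ne
  refine ⟨(volume (Metric.ball (0 : Euc n) 1)).toNNReal, ?_, fun x r => ?_⟩
  · exact ENNReal.toNNReal_pos (Metric.measure_ball_pos _ _ one_pos).ne' hfin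
  · rw [Measure.addHaar_ball volume x r.coe_nonneg, ENNReal.coe_mul, ENNReal.coe_toNNReal hfin,
      finrank_euclideanSpace_fin, ← NNReal.coe_pow, ENNReal.ofReal_coe_nnreal]

/-- A single good point bounds the infimum from above. This verifies the admissible range in (A1),
whose infimum runs over all points, from bounds known only almost everywhere. -/
theorem le_genInv_phiMinus {B : Set (Euc n)} {s : ℝ≥0} {τ : ℝ≥0∞} {y : Euc n} (hy : y ∈ B ∩ Ω)
    (hmono : Monotone (φ y)) (h : φ y s < τ) : (s : ℝ≥0∞) ≤ genInv (phiMinus Ω φ B) τ := by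
  refine le_iInf₂ fun t ht => ?_
  by_contra! hlt
  have hle : phiMinus Ω φ B t ≤ φ y t := iInf₂_le (f := fun x (_ : x ∈ B ∩ Ω) => φ x t) y hy
  exact (((ht.trans hle).trans (hmono (by exact_mod_cast hlt.le))).trans_lt h).false

/-- Doubling of the gauge. At s = c/ρ one has φ(y, s) < 1/|3B| for some y, because φ grows at most
like the power q ≤ n; so (A1) on 3B bounds the supremum at γs by the infimum at s ≤ 1/ρ. Since 1/ρ
is a fixed multiple of γs, (aDec) closes the estimate. The tripled ball may leave Ω, hence the
intersection. -/
theorem exists_lintegral_dilate_le (hn : n ≠ 0) (hΩ : IsOpen Ω) (hφ : IsConvexPhi Ω φ)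
    (hA0 : CondA0 Ω φ) (hA1 : CondA1 Ω φ) {q : ℝ} (hqn : q ≤ n) (hdec : CondADec Ω φ q) :
    ∃ C ρ₀ : ℝ≥0, 0 < ρ₀ ∧ ∀ b : Euc n × ℝ≥0, 0 < b.2 → b.2 ≤ ρ₀ →
      Metric.ball b.1 (b.2 : ℝ) ⊆ Ω →
      ∫⁻ x in Metric.ball b.1 ((3 * b.2 : ℝ≥0) : ℝ) ∩ Ω, φ x (b.2)⁻¹ ≤ C * hBall φ b := by
  obtain ⟨v₁, hv0, hvol⟩ := exists_volume_ball_eq hn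
  obtain ⟨L, hL1, hL⟩ := hdec.le_mul hφ
  obtain ⟨β, hβ0, hβ1, hβ, -⟩ := hA0
  obtain ⟨γ, hγ0, hγ1, hγ⟩ := hA1
  -- With d > L v₁ the bound L (s/β)^n = L (3dρ)^(-n) is strictly below 1/|3B|; the 3 in c matches
  -- the tripled radius.
  set d : ℝ≥0 := L * v₁ + 1 with hd
  have hd1 : 1 ≤ d := le_add_of_nonneg_left zero_le
  have hd0 : 0 < d := zero_lt_one.trans_le hd1
  set c : ℝ≥0 := β / (3 * d) with hc
  have hc0 : 0 < c := by positivity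
  have hc1 : c ≤ 1 := by
    refine div_le_one_of_le₀ (hβ1.le.trans ?_) zero_le
    exact one_le_mul (by norm_num) hd1
  have hgrow := ae_le_of_phiPlus_le_one hΩ.measurableSet hβ hL
  set κ : ℝ≥0 := (γ * c)⁻¹ with hκ
  refine ⟨L * κ ^ q * 3 ^ n, β / (3 * d), hc0, ?_⟩
  rintro ⟨x₀, ρ⟩ (hρ : 0 < ρ) (hρc : ρ ≤ c) (hB : Metric.ball x₀ (ρ : ℝ) ⊆ Ω)
  set B' := Metric.ball x₀ ((3 * ρ : ℝ≥0) : ℝ) with hB'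
  have hBB' : Metric.ball x₀ (ρ : ℝ) ⊆ B' :=
    Metric.ball_subset_ball (by exact_mod_cast le_mul_of_one_le_left hρ.le (by norm_num))
  set s : ℝ≥0 := c / ρ with hs
  have hs1 : 1 ≤ s := (one_le_div hρ).2 hρc
  have hacB : volume.restrict (Metric.ball x₀ (ρ : ℝ)) ≤ volume.restrict Ω :=
    Measure.restrict_mono_set _ hB
  have hgood : ∃ y ∈ B' ∩ Ω, Monotone (φ y) ∧ φ y s < (volume B')⁻¹ := by
    have hne : NeBot (ae (volume.restrict (Metric.ball x₀ (ρ : ℝ)))) := by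
      rw [ae_neBot]
      intro h0
      have := Metric.measure_ball_pos volume x₀ (NNReal.coe_pos.2 hρ)
      rw [Measure.restrict_eq_zero] at h0
      exact this.ne' h0
    obtain ⟨y, ⟨hyg, hym⟩, hyB⟩ := (Eventually.and
      (Eventually.and (ae_mono hacB hgrow) (ae_mono hacB hφ.monotone))
      (ae_restrict_mem Metric.isOpen_ball.measurableSet)).exists
    refine ⟨y, ⟨hBB' hyB, hB hyB⟩, hym, ?_⟩
    have hk1 : 1 ≤ s / β := (one_le_div hβ0).2 (hβ1.le.trans hs1)
    have hk := hyg _ hk1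
    rw [div_mul_cancel₀ _ hβ0.ne'] at hk
    refine hk.trans_lt ?_
    rw [hvol, ← ENNReal.coe_inv (by positivity), ENNReal.coe_lt_coe]
    have hle : (s / β) ^ q ≤ (s / β) ^ n := by
      rw [← NNReal.rpow_natCast]
      exact NNReal.rpow_le_rpow_of_exponent_le hk1 hqn
    have hsb : s / β = (3 * d * ρ)⁻¹ := by
      rw [hs, hc]; field_simp
    calc L * (s / β) ^ q ≤ L * (s / β) ^ n := by gcongr
      _ = (L * v₁ / d ^ n) * ((3 * ρ) ^ n * v₁)⁻¹ := by
        rw [hsb, inv_pow, mul_pow, mul_pow, mul_pow]; field_simp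
      _ < 1 * ((3 * ρ) ^ n * v₁)⁻¹ := by
        refine mul_lt_mul_of_pos_right ?_ (by positivity)
        rw [div_lt_one (by positivity)]
        calc L * v₁ < d := lt_add_one _
          _ ≤ d ^ n := le_self_pow₀ hd1 hn
      _ = _ := one_mul _
  obtain ⟨y, hy, hym, hyτ⟩ := hgood
  have hgen := le_genInv_phiMinus hy hym hyτ
  have hA1' := hγ x₀ (3 * ρ : ℝ≥0) (by positivity)
    ((by exact_mod_cast hs1 : (1 : ℝ≥0∞) ≤ s).trans hgen) s hs1 hgen
  set I := phiPlus Ω φ B' (γ * s)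
  have hinv : ρ⁻¹ = κ * (γ * s) := by
    rw [hκ, hs]; field_simp
  have hκ1 : 1 ≤ κ := (one_le_inv₀ (by positivity)).2 (mul_le_one₀ hγ1.le zero_le hc1)
  have hupper : ∀ᵐ x ∂volume.restrict (B' ∩ Ω), φ x ρ⁻¹ ≤ ((L * κ ^ q : ℝ≥0) : ℝ≥0∞) * I := by
    filter_upwards [ae_mono (Measure.restrict_mono_set _ Set.inter_subset_right) hL,
      ae_restrict_mem (Metric.isOpen_ball.inter hΩ).measurableSet] with x hx hxm
    rw [hinv]
    refine (hx κ _ hκ1).trans ?_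
    gcongr
    exact le_iSup₂ (f := fun x (_ : x ∈ B' ∩ Ω) => φ x (γ * s)) x hxm
  have hlower : I * volume (Metric.ball x₀ (ρ : ℝ)) ≤ hBall φ (x₀, ρ) := by
    rw [← setLIntegral_const, hBall]
    refine lintegral_mono_ae ?_
    filter_upwards [(ae_mono hacB) hφ.monotone,
      ae_restrict_mem Metric.isOpen_ball.measurableSet] with x hx hxm
    refine (hA1'.trans (iInf₂_le (f := fun x (_ : x ∈ B' ∩ Ω) => φ x s) x
      ⟨hBB' hxm, hB hxm⟩)).trans (hx ?_)
    rw [hs, div_eq_mul_inv]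
    exact mul_le_of_le_one_left zero_le hc1
  calc ∫⁻ x in B' ∩ Ω, φ x ρ⁻¹
      ≤ ∫⁻ x in B' ∩ Ω, ((L * κ ^ q : ℝ≥0) : ℝ≥0∞) * I := lintegral_mono_ae hupper
    _ = ((L * κ ^ q : ℝ≥0) : ℝ≥0∞) * I * volume (B' ∩ Ω) := setLIntegral_const _ _
    _ ≤ ((L * κ ^ q : ℝ≥0) : ℝ≥0∞) * I * volume B' := by gcongr; exact Set.inter_subset_left
    _ = ((L * κ ^ q * 3 ^ n : ℝ≥0) : ℝ≥0∞) * (I * volume (Metric.ball x₀ (ρ : ℝ))) := by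
      rw [hvol, hvol, mul_pow]; push_cast; ring
    _ ≤ _ := by gcongr

/-- By (A0), φ(x, 1/β) ≥ 1, and φ(x, s)/s almost increases, so φ(x, 1/ρ) ≳ 1/ρ. The gain of a factor
ρ over the gauge is what makes E a null set. -/
theorem exists_volume_ball_le_hBall (hφ : IsConvexPhi Ω φ) (hA0 : CondA0 Ω φ) :
    ∃ C ρ₀ : ℝ≥0, 0 < ρ₀ ∧ ∀ b : Euc n × ℝ≥0, 0 < b.2 → b.2 ≤ ρ₀ →
      Metric.ball b.1 (b.2 : ℝ) ⊆ Ω →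
      volume (Metric.ball b.1 (b.2 : ℝ)) ≤ ((C * b.2 : ℝ≥0) : ℝ≥0∞) * hBall φ b := by
  obtain ⟨β, hβ0, hβ1, -, hβ⟩ := hA0
  obtain ⟨L, -, hL⟩ := hφ.almost_increasing
  refine ⟨L * β⁻¹, β, hβ0, ?_⟩
  rintro ⟨x₀, ρ⟩ (hρ : 0 < ρ) (hρβ : ρ ≤ β) (hB : Metric.ball x₀ (ρ : ℝ) ⊆ Ω)
  have hacB : volume.restrict (Metric.ball x₀ (ρ : ℝ)) ≤ volume.restrict Ω :=
    Measure.restrict_mono_set _ hB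
  have key : ∀ᵐ x ∂volume.restrict (Metric.ball x₀ (ρ : ℝ)),
      1 ≤ ((L * β⁻¹ * ρ : ℝ≥0) : ℝ≥0∞) * φ x ρ⁻¹ := by
    filter_upwards [(ae_mono hacB) hL, ae_restrict_mem Metric.isOpen_ball.measurableSet] with x hx hxm
    have h1 : (1 : ℝ≥0∞) ≤ φ x β⁻¹ :=
      hβ.trans (iInf₂_le (f := fun x (_ : x ∈ Set.univ ∩ Ω) => φ x β⁻¹) x ⟨trivial, hB hxm⟩)
    have h2 := hx β⁻¹ ρ⁻¹ (by positivity) (by gcongr)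
    rw [ENNReal.div_le_iff (by simpa using hβ0.ne') (by simp)] at h2
    refine h1.trans (h2.trans (le_of_eq ?_))
    rw [ENNReal.coe_inv hρ.ne', ENNReal.div_eq_inv_mul, inv_inv]
    push_cast
    ring
  calc volume (Metric.ball x₀ (ρ : ℝ)) = ∫⁻ x in Metric.ball x₀ (ρ : ℝ), 1 := by simp
    _ ≤ ∫⁻ x in Metric.ball x₀ (ρ : ℝ), ((L * β⁻¹ * ρ : ℝ≥0) : ℝ≥0∞) * φ x ρ⁻¹ :=
      lintegral_mono_ae key
    _ = _ := lintegral_const_mul' _ _ ENNReal.coe_ne_top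

theorem exists_isBallCover {E : Set (Euc n)} {M : ℝ≥0∞} (hM : hausdorffPhi φ Ω E < M) {δ : ℝ≥0}
    (hδ : 0 < δ) : ∃ C, IsBallCover Ω E δ C ∧ ∑' b : C, hBall φ b < M := by
  have : hausdorffDelta φ Ω δ E < M :=
    (le_iSup₂ (f := fun (δ : ℝ≥0) (_ : 0 < δ) => hausdorffDelta φ Ω δ E) δ hδ).trans_lt hM
  simpa [hausdorffDelta, iInf_lt_iff] using this

theorem volume_eq_zero_of_hausdorffPhi_lt_top (hφ : IsConvexPhi Ω φ)
    (hA0 : CondA0 Ω φ) {E : Set (Euc n)} (hE : hausdorffPhi φ Ω E < ⊤) : volume E = 0 := by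
  obtain ⟨C, ρ₀, hρ₀, hC⟩ := exists_volume_ball_le_hBall hφ hA0
  obtain ⟨M, hEM, hM⟩ := exists_between hE
  lift M to ℝ≥0 using hM.ne
  have key : ∀ δ : ℝ≥0, 0 < δ → δ ≤ ρ₀ → volume E ≤ ((C * δ * M : ℝ≥0) : ℝ≥0∞) := by
    intro δ hδ hδρ
    obtain ⟨S, hS, hSM⟩ := exists_isBallCover hEM hδ
    have := hS.countable.to_subtype
    calc volume E ≤ volume (⋃ b ∈ S, Metric.ball b.1 (b.2 : ℝ)) := measure_mono hS.covers
      _ ≤ ∑' b : S, volume (Metric.ball b.1.1 (b.1.2 : ℝ)) := measure_biUnion_le _ hS.countable _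
      _ ≤ ∑' b : S, ((C * δ : ℝ≥0) : ℝ≥0∞) * hBall φ b := by
        refine ENNReal.tsum_le_tsum fun b => (hC b (hS.radius_pos b b.2)
          ((hS.radius_le b b.2).trans hδρ) (hS.subset b b.2)).trans ?_
        gcongr
        exact hS.radius_le b b.2
      _ ≤ ((C * δ : ℝ≥0) : ℝ≥0∞) * M := by rw [ENNReal.tsum_mul_left]; gcongr
      _ = _ := by push_cast; ring
  refine le_antisymm ?_ zero_le
  have hlim : Tendsto (fun δ : ℝ≥0 => ((C * δ * M : ℝ≥0) : ℝ≥0∞)) (𝓝[>] 0) (𝓝 0) := by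
    have : Tendsto (fun δ : ℝ≥0 => ((C * δ * M : ℝ≥0) : ℝ≥0∞)) (𝓝 0)
        (𝓝 ((C * 0 * M : ℝ≥0) : ℝ≥0∞)) :=
      (ENNReal.continuous_coe.comp (by fun_prop : Continuous fun δ : ℝ≥0 => C * δ * M)).tendsto 0
    simpa using this.mono_left nhdsWithin_le_nhds
  refine ge_of_tendsto hlim ?_
  filter_upwards [Ioc_mem_nhdsGT hρ₀] with δ hδ using key δ hδ.1 hδ.2

end

section

/-! ### Weak gradients and test functions -/

variable {Ω U : Set (Euc n)} {φ : Euc n → ℝ≥0 → ℝ≥0∞}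

theorem IsTestFunction.integrableOn_smul {F : Type*} [NormedAddCommGroup F] [NormedSpace ℝ F]
    {ψ : Euc n → ℝ} (hψ : IsTestFunction U ψ) {g : Euc n → F} (hg : LocallyIntegrableOn g U) :
    Integrable (fun x => ψ x • g x) := by
  have h1 : IntegrableOn g (tsupport ψ) :=
    hg.integrableOn_compact_subset hψ.support_subset hψ.compact_support
  have h2 : IntegrableOn (fun x => ψ x • g x) (tsupport ψ) :=
    h1.continuousOn_smul hψ.smooth.continuous.continuousOn hψ.compact_support
  refine (integrableOn_iff_integrable_of_support_subset fun x hx => ?_).1 h2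
  by_contra hx'
  exact hx (by simp [image_eq_zero_of_notMem_tsupport hx'])

theorem HasWeakGradient.ae_eq (hU : IsOpen U) {u : Euc n → ℝ} {g g' : Euc n → Euc n}
    (h : HasWeakGradient U u g) (h' : HasWeakGradient U u g') : g =ᵐ[volume.restrict U] g' := by
  have key := hU.ae_eq_zero_of_integral_contDiff_smul_eq_zero (μ := volume)
    (f := fun x => g x - g' x) (h.locallyIntegrable_grad.sub h'.locallyIntegrable_grad) (by
      intro η h1 h2 h3
      have hη : IsTestFunction U η := ⟨h1, h2, h3⟩
      have e : ∫ x in U, η x • g x = ∫ x in U, η x • g' x := by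
        rw [← neg_inj, ← h.integral_eq η hη, ← h'.integral_eq η hη]
      simp only [smul_sub]
      rw [integral_sub (hη.integrableOn_smul h.locallyIntegrable_grad)
        (hη.integrableOn_smul h'.locallyIntegrable_grad)]
      have aux : ∀ f : Euc n → Euc n, ∫ x in U, η x • f x = ∫ x, η x • f x := fun f =>
        setIntegral_eq_integral_of_forall_compl_eq_zero fun x hx => by
          simp [image_eq_zero_of_notMem_tsupport fun hx' => hx (h3 hx')]
      rw [← aux, ← aux, e, sub_self])
  rw [EventuallyEq, ae_restrict_iff' hU.measurableSet]
  filter_upwards [key] with x hx hxU using sub_eq_zero.1 (hx hxU)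

theorem continuous_gradient {ψ : Euc n → ℝ} (hψ : ContDiff ℝ ∞ ψ) : Continuous (gradient ψ) :=
  (InnerProductSpace.toDual ℝ (Euc n)).symm.continuous.comp (hψ.continuous_fderiv (by simp))

theorem norm_gradient (ψ : Euc n → ℝ) (x : Euc n) : ‖gradient ψ x‖ = ‖fderiv ℝ ψ x‖ := by
  simp [gradient]

theorem gradient_eq_zero_of_notMem_tsupport {ψ : Euc n → ℝ} {x : Euc n} (hx : x ∉ tsupport ψ) :
    gradient ψ x = 0 := by
  rw [← norm_eq_zero, norm_gradient, norm_eq_zero]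
  exact image_eq_zero_of_notMem_tsupport fun h => hx (tsupport_fderiv_subset ℝ h)

theorem IsTestFunction.hasCompactSupport_gradient {ψ : Euc n → ℝ} (hψ : IsTestFunction U ψ) :
    HasCompactSupport (gradient ψ) :=
  HasCompactSupport.intro hψ.compact_support fun _ => gradient_eq_zero_of_notMem_tsupport

theorem IsTestFunction.mono {V : Set (Euc n)} {ψ : Euc n → ℝ} (hψ : IsTestFunction U ψ)
    (h : U ⊆ V) : IsTestFunction V ψ :=
  ⟨hψ.smooth, hψ.compact_support, hψ.support_subset.trans h⟩

theorem IsTestFunction.integrable {ψ : Euc n → ℝ} (hψ : IsTestFunction U ψ) : Integrable ψ :=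
  hψ.smooth.continuous.integrable_of_hasCompactSupport hψ.compact_support

theorem IsTestFunction.integrable_gradient {ψ : Euc n → ℝ} (hψ : IsTestFunction U ψ) :
    Integrable (gradient ψ) :=
  (continuous_gradient hψ.smooth).integrable_of_hasCompactSupport hψ.hasCompactSupport_gradient

theorem IsTestFunction.hasWeakGradient {ψ : Euc n → ℝ} (hψ : IsTestFunction U ψ) :
    HasWeakGradient U ψ (gradient ψ) where
  locallyIntegrable := hψ.integrable.integrableOn.locallyIntegrableOn
  locallyIntegrable_grad := hψ.integrable_gradient.integrableOn.locallyIntegrableOn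
  integral_eq η hη := by
    have hsupp : ∀ {x}, x ∉ U → x ∉ tsupport η := fun hx h => hx (hη.support_subset h)
    rw [setIntegral_eq_integral_of_forall_compl_eq_zero fun x hx => by
        rw [gradient_eq_zero_of_notMem_tsupport (hsupp hx), smul_zero],
      setIntegral_eq_integral_of_forall_compl_eq_zero fun x hx => by
        rw [image_eq_zero_of_notMem_tsupport (hsupp hx), zero_smul]]
    have c1 := continuous_gradient hψ.smooth
    have c2 := continuous_gradient hη.smooth
    have c3 := hψ.smooth.continuous
    have c4 := hη.smooth.continuous
    have i1 : Integrable fun x => ψ x • gradient η x :=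
      (c3.smul c2).integrable_of_hasCompactSupport hψ.compact_support.smul_right
    have i2 : Integrable fun x => η x • gradient ψ x :=
      (c4.smul c1).integrable_of_hasCompactSupport hη.compact_support.smul_right
    -- Pairing with a fixed vector v reduces the vector identity to scalar integration by parts in
    -- direction v.
    refine ext_inner_right ℝ fun v => ?_
    rw [inner_neg_left, real_inner_comm, real_inner_comm _ (∫ x, η x • gradient ψ x),
      ← integral_inner i1, ← integral_inner i2]
    have e1 : ∀ x, ⟪v, ψ x • gradient η x⟫ = ψ x * fderiv ℝ η x v := fun x => by
      rw [inner_smul_right, real_inner_comm, inner_gradient_left]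
    have e2 : ∀ x, ⟪v, η x • gradient ψ x⟫ = fderiv ℝ ψ x v * η x := fun x => by
      rw [inner_smul_right, real_inner_comm, inner_gradient_left, mul_comm]
    have j1 := i1.const_inner (𝕜 := ℝ) v
    have j2 := i2.const_inner (𝕜 := ℝ) v
    simp only [e1] at j1 ⊢
    simp only [e2] at j2 ⊢
    exact integral_mul_fderiv_eq_neg_fderiv_mul_of_integrable j2 j1
      ((c3.mul c4).integrable_of_hasCompactSupport hψ.compact_support.mul_right)
      (fun x _ => (hψ.smooth.differentiable (by simp)) x)
      (fun x _ => (hη.smooth.differentiable (by simp)) x)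

theorem modular_lt_top_of_bounded {F : Type*} [NormedAddCommGroup F] {q : ℝ} (hΩ : MeasurableSet Ω)
    (hΩb : Bornology.IsBounded Ω) (hφ : IsConvexPhi Ω φ) (hA0 : CondA0 Ω φ)
    (hdec : CondADec Ω φ q) (hU : U ⊆ Ω) {f : Euc n → F} {S : ℝ≥0} (hf : ∀ x, ‖f x‖₊ ≤ S) :
    modular φ U f < ⊤ := by
  obtain ⟨C, hC⟩ := exists_ae_le_coe hΩ hφ hA0 hdec S
  have hle : volume.restrict U ≤ volume.restrict Ω := Measure.restrict_mono_set _ hU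
  calc modular φ U f ≤ ∫⁻ _ in U, (C : ℝ≥0∞) := by
        refine lintegral_mono_ae ?_
        filter_upwards [ae_mono hle hC, ae_mono hle hφ.monotone] with x hx hm
          using (hm (hf x)).trans hx
    _ = C * volume U := setLIntegral_const _ _
    _ < ⊤ := ENNReal.mul_lt_top ENNReal.coe_lt_top (hΩb.subset hU).measure_lt_top

theorem luxNorm_eq_zero {F : Type*} [NormedAddCommGroup F] (hφ : IsConvexPhi Ω φ) (hU : U ⊆ Ω)
    {f : Euc n → F} (hf : ∀ x, f x = 0) : luxNorm φ U f = 0 := by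
  have hle : volume.restrict U ≤ volume.restrict Ω := Measure.restrict_mono_set _ hU
  refine le_antisymm (ENNReal.le_of_forall_pos_le_add fun ε hε _ => ?_) zero_le
  rw [zero_add]
  refine iInf₂_le ε ⟨hε, ?_⟩
  rw [lintegral_congr_ae (g := fun _ => 0)]
  · simp
  · filter_upwards [ae_mono hle hφ.zero] with x hx
    simp [hf, hx]

theorem IsTestFunction.memW10 {q : ℝ} (hΩ : MeasurableSet Ω)
    (hΩb : Bornology.IsBounded Ω) (hφ : IsConvexPhi Ω φ) (hA0 : CondA0 Ω φ)
    (hdec : CondADec Ω φ q) (hU : U ⊆ Ω) {ψ : Euc n → ℝ} (hψ : IsTestFunction U ψ) :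
    MemW10 φ U ψ := by
  obtain ⟨S, hS⟩ := hψ.compact_support.exists_bound_of_continuous hψ.smooth.continuous
  obtain ⟨T, hT⟩ := hψ.hasCompactSupport_gradient.exists_bound_of_continuous
    (continuous_gradient hψ.smooth)
  refine ⟨⟨gradient ψ, hψ.hasWeakGradient, hψ.integrable.integrableOn,
    hψ.integrable_gradient.integrableOn,
    modular_lt_top_of_bounded hΩ hΩb hφ hA0 hdec hU (S := S.toNNReal)
      fun x => NNReal.le_toNNReal_of_coe_le (hS x),
    modular_lt_top_of_bounded hΩ hΩb hφ hA0 hdec hU (S := T.toNNReal)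
      fun x => NNReal.le_toNNReal_of_coe_le (hT x)⟩,
    gradient ψ, hψ.hasWeakGradient, fun ε hε => ⟨ψ, hψ, ?_⟩⟩
  rw [luxNorm_eq_zero hφ hU fun x => sub_self _, luxNorm_eq_zero hφ hU fun x => sub_self _]
  simpa using hε

end

section


/-! ### Smooth cutoff functions for finite families of balls -/

theorem exists_bump_gradient_bound (n : ℕ) : ∃ (η : Euc n → ℝ) (C : ℝ), ContDiff ℝ ∞ η ∧
    (∀ x ∈ Metric.ball (0 : Euc n) 1, η x = 1) ∧
    (∀ x ∉ Metric.ball (0 : Euc n) 3, η x = 0) ∧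
    (∀ x ∉ Metric.ball (0 : Euc n) 3, fderiv ℝ η x = 0) ∧ ∀ x, ‖fderiv ℝ η x‖ ≤ C := by
  let η : ContDiffBump (0 : Euc n) := ⟨1, 2, one_pos, one_lt_two⟩
  have hη : ContDiff ℝ ∞ η := η.contDiff
  obtain ⟨C, hC⟩ := (η.hasCompactSupport.fderiv (𝕜 := ℝ)).exists_bound_of_continuous
    (hη.continuous_fderiv (by simp))
  have hsupp : ∀ x ∉ Metric.ball (0 : Euc n) 3, x ∉ tsupport η := by
    intro x hx h
    rw [η.tsupport_eq] at h
    exact hx (Metric.closedBall_subset_ball (by norm_num [η]) h)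
  refine ⟨η, C, hη, fun x hx => ?_,
    fun x hx => image_eq_zero_of_notMem_tsupport (hsupp x hx), fun x hx => ?_, hC⟩
  · exact η.one_of_mem_closedBall (Metric.ball_subset_closedBall hx)
  · exact image_eq_zero_of_notMem_tsupport fun h => hsupp x hx (tsupport_fderiv_subset ℝ h)

/-- A smooth step from `0` (on `(-∞, 1/2]`) to `1` (on `[1, ∞)`) with bounded derivative. -/
theorem exists_smooth_step : ∃ (χ : ℝ → ℝ) (C : ℝ), ContDiff ℝ ∞ χ ∧ (∀ t, 0 ≤ χ t) ∧
    (∀ t, χ t ≤ 1) ∧ (∀ t ≤ 1 / 2, χ t = 0) ∧ (∀ t, 1 ≤ t → χ t = 1) ∧ ∀ t, |deriv χ t| ≤ C := by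
  let χ : ℝ → ℝ := fun t => Real.smoothTransition (2 * t - 1)
  have hχ : ContDiff ℝ ∞ χ := Real.smoothTransition.contDiff.comp (by fun_prop)
  have h0 : ∀ t ≤ 1 / 2, χ t = 0 := fun t ht =>
    Real.smoothTransition.zero_of_nonpos (by linarith)
  have h1 : ∀ t, 1 ≤ t → χ t = 1 := fun t ht => Real.smoothTransition.one_of_one_le (by linarith)
  have hcs : HasCompactSupport (deriv χ) := by
    refine HasCompactSupport.intro (isCompact_Icc (a := (1 / 2 : ℝ)) (b := 1)) fun t ht => ?_
    rw [Set.mem_Icc, not_and_or, not_le, not_le] at ht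
    rcases ht with ht | ht
    · have : χ =ᶠ[𝓝 t] fun _ => 0 := by
        filter_upwards [Iio_mem_nhds ht] with s hs using h0 s (le_of_lt hs)
      rw [this.deriv_eq, deriv_const]
    · have : χ =ᶠ[𝓝 t] fun _ => 1 := by
        filter_upwards [Ioi_mem_nhds ht] with s hs using h1 s (le_of_lt hs)
      rw [this.deriv_eq, deriv_const]
  obtain ⟨C, hC⟩ := hcs.exists_bound_of_continuous (hχ.continuous_deriv (by simp))
  exact ⟨χ, C, hχ, fun t => Real.smoothTransition.nonneg _, fun t => Real.smoothTransition.le_one _,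
    h0, h1, hC⟩

/-- A smooth substitute for the maximum of finitely many cutoff functions: the derivative is
controlled by the largest derivative of the family. -/
theorem exists_smooth_max {ι : Type*} (s : Finset ι) {C : ℝ} {χ : ℝ → ℝ}
    (hχ : ContDiff ℝ ∞ χ) (hχ0 : ∀ t ≤ 1 / 2, χ t = 0) (hχ1 : ∀ t, 1 ≤ t → χ t = 1)
    (hC : ∀ t, |deriv χ t| ≤ C) (f : ι → Euc n → ℝ)
    (hf : ∀ i ∈ s, ContDiff ℝ ∞ (f i)) :
    ∃ w : Euc n → ℝ, ContDiff ℝ ∞ w ∧ (∀ x, ∃ t, w x = χ t) ∧ (∀ x, (∃ i ∈ s, f i x = 1) → w x = 1) ∧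
      (∀ x, (∀ i ∈ s, f i x = 0) → w x = 0) ∧
      ∀ x (M : ℝ), 0 ≤ M → (∀ i ∈ s, ‖fderiv ℝ (f i) x‖ ≤ M) → ‖fderiv ℝ w x‖ ≤ C * M := by
  -- Log-sum-exp: (log S)/lam is at least 1 where some f_i = 1, and at most 1/2 where all f_i = 0
  -- because lam ≥ 2 log(1 + card). The summand 1 in lam and in S covers the empty family.
  set lam : ℝ := 2 * Real.log (1 + s.card) + 1 with hlam
  have hlog : 0 ≤ Real.log (1 + s.card) := Real.log_nonneg (by simp)
  have hlam0 : 0 < lam := by positivity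
  set S : Euc n → ℝ := fun x => 1 + ∑ i ∈ s, Real.exp (lam * f i x) with hS
  have hpos : ∀ x, 0 < S x := fun x => by
    have : 0 ≤ ∑ i ∈ s, Real.exp (lam * f i x) := Finset.sum_nonneg fun i _ => (Real.exp_pos _).le
    simp only [hS]; linarith
  have hSsm : ContDiff ℝ ∞ S := contDiff_const.add
    (ContDiff.sum fun i hi => (contDiff_const.mul (hf i hi)).exp)
  have hlogsm : ContDiff ℝ ∞ fun x => Real.log (S x) / lam :=
    (hSsm.log fun x => (hpos x).ne').div_const _
  refine ⟨fun x => χ (Real.log (S x) / lam), hχ.comp hlogsm, fun x => ⟨_, rfl⟩, ?_, ?_, ?_⟩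
  · rintro x ⟨i, hi, hfi⟩
    refine hχ1 _ ((one_le_div hlam0).2 ?_)
    rw [Real.le_log_iff_exp_le (hpos x)]
    have := Finset.single_le_sum (f := fun i => Real.exp (lam * f i x))
      (fun i _ => (Real.exp_pos _).le) hi
    simp only [hfi, mul_one] at this
    simp only [hS]; linarith
  · intro x hx
    refine hχ0 _ ?_
    have : S x = 1 + s.card := by
      simp only [hS]
      rw [Finset.sum_congr rfl fun i hi => by rw [hx i hi, mul_zero, Real.exp_zero]]
      simp
    change Real.log (S x) / lam ≤ 1 / 2
    rw [this, div_le_iff₀ hlam0, hlam]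
    linarith
  · intro x M hM hfM
    have hfd : ∀ i ∈ s, HasFDerivAt (fun x => Real.exp (lam * f i x))
        (Real.exp (lam * f i x) • lam • fderiv ℝ (f i) x) x := fun i hi =>
      ((((hf i hi).differentiable (by simp)) x).hasFDerivAt.const_mul lam).exp
    have hSd : HasFDerivAt S (∑ i ∈ s, Real.exp (lam * f i x) • lam • fderiv ℝ (f i) x) x := by
      simpa [hS] using (HasFDerivAt.fun_sum hfd).const_add 1
    have hwd : HasFDerivAt (fun x => χ (Real.log (S x) / lam))
        (deriv χ (Real.log (S x) / lam) • lam⁻¹ • (S x)⁻¹ •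
          ∑ i ∈ s, Real.exp (lam * f i x) • lam • fderiv ℝ (f i) x) x := by
      have h1 := (hSd.log (hpos x).ne').const_mul lam⁻¹
      have h2 : HasDerivAt χ (deriv χ (Real.log (S x) / lam)) (lam⁻¹ * Real.log (S x)) := by
        rw [div_eq_inv_mul]
        exact ((hχ.differentiable (by simp)) _).hasDerivAt
      have h3 := h2.comp_hasFDerivAt x h1
      refine h3.congr_of_eventuallyEq (Eventually.of_forall fun y => ?_)
      simp [div_eq_inv_mul]
    rw [hwd.fderiv]
    -- The gradient of (log S)/lam combines the gradients of the f_i with weights exp(lam f_i)/S of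
    -- total at most 1, so neither the number of functions nor lam enters the bound.
    have hsum : ‖∑ i ∈ s, Real.exp (lam * f i x) • lam • fderiv ℝ (f i) x‖ ≤ S x * (lam * M) := by
      calc _ ≤ ∑ i ∈ s, Real.exp (lam * f i x) * (lam * M) := by
            refine norm_sum_le_of_le _ fun i hi => ?_
            rw [norm_smul, norm_smul, Real.norm_of_nonneg (Real.exp_pos _).le,
              Real.norm_of_nonneg hlam0.le]
            gcongr
            exact hfM i hi
        _ = (∑ i ∈ s, Real.exp (lam * f i x)) * (lam * M) := by rw [Finset.sum_mul]
        _ ≤ S x * (lam * M) := by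
            gcongr
            simp only [hS]; linarith
    rw [norm_smul, norm_smul, norm_smul, Real.norm_of_nonneg (inv_nonneg.2 hlam0.le),
      Real.norm_of_nonneg (inv_nonneg.2 (hpos x).le), Real.norm_eq_abs]
    have hx0 := hpos x
    have hC0 : 0 ≤ C := (abs_nonneg _).trans (hC 0)
    calc |deriv χ (Real.log (S x) / lam)| * (lam⁻¹ * ((S x)⁻¹ * _))
        ≤ C * (lam⁻¹ * ((S x)⁻¹ * (S x * (lam * M)))) := by
          gcongr
          exact hC _
      _ = C * M := by field_simp

/-- Cutoff functions for finitely many balls. -/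
theorem exists_cutoff (n : ℕ) : ∃ C : ℝ, 0 ≤ C ∧ ∀ s : Finset (Euc n × ℝ≥0), (∀ b ∈ s, 0 < b.2) →
    ∃ w : Euc n → ℝ, ContDiff ℝ ∞ w ∧ (∀ x, 0 ≤ w x) ∧ (∀ x, w x ≤ 1) ∧
      (∀ b ∈ s, ∀ x ∈ Metric.ball b.1 (b.2 : ℝ), w x = 1) ∧
      ∀ x, (w x = 0 ∧ fderiv ℝ w x = 0) ∨
        ∃ b ∈ s, x ∈ Metric.ball b.1 ((3 * b.2 : ℝ≥0) : ℝ) ∧ ‖fderiv ℝ w x‖ ≤ C * (b.2 : ℝ)⁻¹ := by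
  obtain ⟨η, C₁, hη, hη1, hη0, hη0', hC₁⟩ := exists_bump_gradient_bound n
  obtain ⟨χ, C₂, hχ, hχn, hχl, hχ0, hχ1, hC₂⟩ := exists_smooth_step
  have hC₁0 : 0 ≤ C₁ := (norm_nonneg _).trans (hC₁ 0)
  have hC₂0 : 0 ≤ C₂ := (abs_nonneg _).trans (hC₂ 0)
  refine ⟨C₂ * C₁, by positivity, fun s hs => ?_⟩
  let f : Euc n × ℝ≥0 → Euc n → ℝ := fun b x => η ((b.2 : ℝ)⁻¹ • (x - b.1))
  have hf : ∀ b ∈ s, ContDiff ℝ ∞ (f b) := fun b _ => hη.comp (by fun_prop)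
  have hfd : ∀ b x, fderiv ℝ (f b) x = (b.2 : ℝ)⁻¹ • fderiv ℝ η ((b.2 : ℝ)⁻¹ • (x - b.1)) := by
    intro b x
    have h1 : HasFDerivAt (fun x : Euc n => (b.2 : ℝ)⁻¹ • (x - b.1))
        ((b.2 : ℝ)⁻¹ • ContinuousLinearMap.id ℝ (Euc n)) x :=
      ((hasFDerivAt_id x).sub_const b.1).fun_const_smul _
    have h2 := (((hη.differentiable (by simp)) ((b.2 : ℝ)⁻¹ • (x - b.1))).hasFDerivAt).comp x h1
    rw [show f b = η ∘ fun x => (b.2 : ℝ)⁻¹ • (x - b.1) from rfl, h2.fderiv]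
    ext v
    simp
  have hmem : ∀ b ∈ s, ∀ (r : ℝ≥0) (x : Euc n), (b.2 : ℝ)⁻¹ • (x - b.1) ∈ Metric.ball (0 : Euc n) r ↔
      x ∈ Metric.ball b.1 ((r * b.2 : ℝ≥0) : ℝ) := by
    intro b hb r x
    have hb' : (0 : ℝ) < b.2 := NNReal.coe_pos.2 (hs b hb)
    rw [mem_ball_zero_iff, norm_smul, Real.norm_of_nonneg (inv_nonneg.2 hb'.le), mem_ball_iff_norm,
      inv_mul_lt_iff₀ hb', NNReal.coe_mul, mul_comm]
  have hmem3 : ∀ b ∈ s, ∀ x : Euc n, x ∉ Metric.ball b.1 ((3 * b.2 : ℝ≥0) : ℝ) →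
      (b.2 : ℝ)⁻¹ • (x - b.1) ∉ Metric.ball (0 : Euc n) 3 := by
    intro b hb x hx h
    rw [← hmem b hb 3 x, NNReal.coe_ofNat] at hx
    exact hx h
  obtain ⟨w, hw1, hwχ, hw2, hw3, hw4⟩ := exists_smooth_max s hχ hχ0 hχ1 hC₂ f hf
  have hw0 : ∀ x, 0 ≤ w x := fun x => by obtain ⟨t, ht⟩ := hwχ x; rw [ht]; exact hχn t
  have hwl : ∀ x, w x ≤ 1 := fun x => by obtain ⟨t, ht⟩ := hwχ x; rw [ht]; exact hχl t
  refine ⟨w, hw1, hw0, hwl, fun b hb x hx => hw2 x ⟨b, hb, hη1 _ ?_⟩,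
    fun x => ?_⟩
  · have := (hmem b hb 1 x).2 (by simpa using hx)
    simpa using this
  · by_cases hx : ∃ b ∈ s, x ∈ Metric.ball b.1 ((3 * b.2 : ℝ≥0) : ℝ)
    · right
      classical
      obtain ⟨b₀, hb₀, hxb₀⟩ := hx
      set t := s.filter fun b => x ∈ Metric.ball b.1 ((3 * b.2 : ℝ≥0) : ℝ) with ht
      have hmt : ∀ b, b ∈ t ↔ b ∈ s ∧ x ∈ Metric.ball b.1 ((3 * b.2 : ℝ≥0) : ℝ) := fun b => by
        rw [ht, Finset.mem_filter]
      -- The smallest tripled ball containing x gives the largest slope; bumps of balls not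
      -- containing x have zero derivative there.
      obtain ⟨b, hb, hbmax⟩ := Finset.exists_max_image t (fun b => (b.2)⁻¹)
        ⟨b₀, (hmt b₀).2 ⟨hb₀, hxb₀⟩⟩
      rw [hmt] at hb
      refine ⟨b, hb.1, hb.2, ?_⟩
      rw [mul_assoc]
      refine hw4 x (C₁ * (b.2 : ℝ)⁻¹) (by positivity) fun a ha => ?_
      by_cases hxa : x ∈ Metric.ball a.1 ((3 * a.2 : ℝ≥0) : ℝ)
      · have hle : (a.2 : ℝ)⁻¹ ≤ (b.2 : ℝ)⁻¹ := by
          exact_mod_cast hbmax a ((hmt a).2 ⟨ha, hxa⟩)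
        rw [hfd, norm_smul, Real.norm_of_nonneg (by positivity), mul_comm]
        exact mul_le_mul (hC₁ _) hle (by positivity) hC₁0
      · rw [hfd, hη0' _ (hmem3 a ha x hxa), smul_zero, norm_zero]
        positivity
    · left
      push Not at hx
      have hx3 : ∀ b ∈ s, (b.2 : ℝ)⁻¹ • (x - b.1) ∉ Metric.ball (0 : Euc n) 3 := fun b hb =>
        hmem3 b hb x (hx b hb)
      refine ⟨hw3 x fun b hb => hη0 _ (hx3 b hb), ?_⟩
      have := hw4 x 0 le_rfl fun b hb => by rw [hfd, hη0' _ (hx3 b hb), smul_zero, norm_zero]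
      rw [mul_zero] at this
      exact norm_le_zero_iff.1 this

end

section

/-! ### Approximation by test functions vanishing near the exceptional set -/

variable {Ω : Set (Euc n)} {φ : Euc n → ℝ≥0 → ℝ≥0∞}

/-- Balls missing K are discarded so that the tripled balls stay in a small neighbourhood of K. -/
theorem IsBallCover.exists_finset {Ω E K : Set (Euc n)} {δ : ℝ≥0} {S : Set (Euc n × ℝ≥0)}
    (hS : IsBallCover Ω E δ S) (hK : IsCompact K) (hKE : K ⊆ E) :
    ∃ t : Finset (Euc n × ℝ≥0), (∀ b ∈ t, b ∈ S) ∧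
      (K ⊆ ⋃ b ∈ t, Metric.ball b.1 (b.2 : ℝ)) ∧
      ∀ b ∈ t, (Metric.ball b.1 (b.2 : ℝ) ∩ K).Nonempty := by
  classical
  obtain ⟨S', hS'S, hfin, hcov⟩ := hK.elim_finite_subcover_image (b := S)
    (c := fun b => Metric.ball b.1 (b.2 : ℝ)) (fun _ _ => Metric.isOpen_ball) (hKE.trans hS.covers)
  refine ⟨hfin.toFinset.filter fun b => (Metric.ball b.1 (b.2 : ℝ) ∩ K).Nonempty, ?_, ?_, ?_⟩
  · intro b hb
    rw [Finset.mem_filter, Set.Finite.mem_toFinset] at hb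
    exact hS'S hb.1
  · intro x hx
    obtain ⟨b, hb, hxb⟩ := Set.mem_iUnion₂.1 (hcov hx)
    refine Set.mem_iUnion₂.2 ⟨b, ?_, hxb⟩
    rw [Finset.mem_filter, Set.Finite.mem_toFinset]
    exact ⟨hb, x, hxb, hx⟩
  · intro b hb
    rw [Finset.mem_filter] at hb
    exact hb.2

theorem lintegral_sum_balls_le (hφ : IsConvexPhi Ω φ)
    {C : ℝ≥0} {M : ℝ≥0∞} {S : Set (Euc n × ℝ≥0)} {t : Finset (Euc n × ℝ≥0)}
    (hC : ∀ b ∈ S, ∫⁻ x in Metric.ball b.1 ((3 * b.2 : ℝ≥0) : ℝ) ∩ Ω, φ x (b.2)⁻¹ ≤ C * hBall φ b)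
    (hM : ∑' b : S, hBall φ b ≤ M) (ht : ∀ b ∈ t, b ∈ S) :
    ∫⁻ x in Ω, ∑ b ∈ t, (Metric.ball b.1 ((3 * b.2 : ℝ≥0) : ℝ)).indicator
      (fun x => φ x (b.2)⁻¹) x ≤ C * M := by
  rw [lintegral_finsetSum' _ fun b _ =>
    (hφ.measurable (b.2)⁻¹).indicator Metric.isOpen_ball.measurableSet]
  calc ∑ b ∈ t, ∫⁻ x in Ω, (Metric.ball b.1 ((3 * b.2 : ℝ≥0) : ℝ)).indicator
        (fun x => φ x (b.2)⁻¹) x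
      ≤ ∑ b ∈ t, C * S.indicator (hBall φ) b := by
        refine Finset.sum_le_sum fun b hb => ?_
        rw [lintegral_indicator Metric.isOpen_ball.measurableSet,
          Measure.restrict_restrict Metric.isOpen_ball.measurableSet,
          Set.indicator_of_mem (ht b hb)]
        exact hC b (ht b hb)
    _ = C * ∑ b ∈ t, S.indicator (hBall φ) b := by rw [Finset.mul_sum]
    _ ≤ C * ∑' b, S.indicator (hBall φ) b := by gcongr; exact ENNReal.sum_le_tsum t
    _ ≤ C * M := by rw [← tsum_subtype]; gcongr

/-- Take v = (1 - w)ψ with w a cutoff of small balls covering F ∩ supp ψ. The point is that C is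
chosen before r. -/
theorem exists_isTestFunction_diff (hn : n ≠ 0) (hΩ : IsOpen Ω) (hφ : IsConvexPhi Ω φ)
    (hA0 : CondA0 Ω φ) (hA1 : CondA1 Ω φ) {q : ℝ} (hqn : q ≤ n) (hdec : CondADec Ω φ q)
    {E F : Set (Euc n)} (hF : IsClosed F) (hEF : E = F ∩ Ω) (hE : hausdorffPhi φ Ω E < ⊤)
    {ψ : Euc n → ℝ} (hψ : IsTestFunction Ω ψ) :
    ∃ C : ℝ≥0, ∀ r : ℝ≥0, 0 < r → ∃ v : Euc n → ℝ, IsTestFunction (Ω \ E) v ∧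
      (∀ x ∉ Metric.cthickening (r : ℝ) (F ∩ tsupport ψ), gradient ψ x - gradient v x = 0) ∧
      modular φ Ω (fun x => gradient ψ x - gradient v x) ≤ C := by
  obtain ⟨Cd, ρ₀, hρ₀, hCd⟩ := exists_lintegral_dilate_le hn hΩ hφ hA0 hA1 hqn hdec
  obtain ⟨L, hL1, hL⟩ := hdec.le_mul hφ
  obtain ⟨Cw, hCw0, hcut⟩ := exists_cutoff n
  obtain ⟨M, hEM, hM⟩ := exists_between hE
  lift M to ℝ≥0 using hM.ne
  obtain ⟨P, hP⟩ := hψ.compact_support.exists_bound_of_continuous hψ.smooth.continuous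
  obtain ⟨T, hT⟩ := (hψ.compact_support.fderiv (𝕜 := ℝ)).exists_bound_of_continuous
    (hψ.smooth.continuous_fderiv (by simp))
  have hP0 : 0 ≤ P := (norm_nonneg _).trans (hP 0)
  have hT0 : 0 ≤ T := (norm_nonneg _).trans (hT 0)
  -- For radii ρ ≤ 1, |wDψ + ψDw| ≤ T + P Cw/ρ ≤ κ/ρ; the maximum with 1 allows κ as a dilation
  -- factor in (aDec).
  set κ : ℝ≥0 := max 1 (T + P * Cw).toNNReal with hκ
  have hκ1 : 1 ≤ κ := le_max_left _ _
  have hκT : T + P * Cw ≤ κ := Real.toNNReal_le_iff_le_coe.1 (le_max_right _ _)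
  refine ⟨L * κ ^ q * (Cd * M), fun r hr => ?_⟩
  -- A point of 3B is within 4ρ ≤ r of a point of K in B; ρ₀ is for doubling, and 1 absorbs T into
  -- T/ρ.
  set δ : ℝ≥0 := min (r / 4) (min ρ₀ 1) with hδ
  have hδ0 : 0 < δ := lt_min (by positivity) (lt_min hρ₀ one_pos)
  obtain ⟨S, hS, hSM⟩ := exists_isBallCover hEM hδ0
  have hKc : IsCompact (F ∩ tsupport ψ) := hψ.compact_support.inter_left hF
  have hKE : F ∩ tsupport ψ ⊆ E := hEF ▸ Set.inter_subset_inter_right _ hψ.support_subset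
  obtain ⟨t, htS, htcov, htK⟩ := hS.exists_finset hKc hKE
  obtain ⟨w, hw, hw0, hw1, hwB, hwx⟩ := hcut t fun b hb => hS.radius_pos b (htS b hb)
  have hδle : ∀ b ∈ t, b.2 ≤ δ := fun b hb => hS.radius_le b (htS b hb)
  set v : Euc n → ℝ := fun x => ψ x - w x * ψ x with hv
  have hvsm : ContDiff ℝ ∞ v := hψ.smooth.sub (hw.mul hψ.smooth)
  have hvψ : tsupport v ⊆ tsupport ψ := by
    refine closure_mono fun x hx hx' => hx ?_
    simp only [hv, hx', mul_zero, sub_zero]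
  have hgrad : ∀ x, gradient ψ x - gradient v x =
      (InnerProductSpace.toDual ℝ (Euc n)).symm (w x • fderiv ℝ ψ x + ψ x • fderiv ℝ w x) := by
    intro x
    have d1 := (hψ.smooth.differentiable (by simp) x).hasFDerivAt
    have d2 := (hw.differentiable (by simp) x).hasFDerivAt
    have d3 : fderiv ℝ v x = fderiv ℝ ψ x - (w x • fderiv ℝ ψ x + ψ x • fderiv ℝ w x) :=
      (d1.sub (d2.mul d1)).fderiv
    rw [gradient, gradient, d3, ← map_sub, sub_sub_cancel]
  have hpt : ∀ x, gradient ψ x - gradient v x = 0 ∨ ∃ b ∈ t,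
      x ∈ Metric.ball b.1 ((3 * b.2 : ℝ≥0) : ℝ) ∧
        ‖gradient ψ x - gradient v x‖₊ ≤ κ * (b.2)⁻¹ := by
    intro x
    rcases hwx x with ⟨h0, h0'⟩ | ⟨b, hb, hxb, hbw⟩
    · left
      rw [hgrad, h0, h0', zero_smul, smul_zero, add_zero, map_zero]
    · refine Or.inr ⟨b, hb, hxb, ?_⟩
      rw [← NNReal.coe_le_coe, coe_nnnorm, hgrad, LinearIsometryEquiv.norm_map]
      have hb1 : (1 : ℝ) ≤ (b.2 : ℝ)⁻¹ := by
        have h1 : b.2 ≤ 1 := (hδle b hb).trans ((min_le_right _ _).trans (min_le_right _ _))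
        have h2 : 0 < b.2 := hS.radius_pos b (htS b hb)
        exact (one_le_inv₀ (NNReal.coe_pos.2 h2)).2 (by exact_mod_cast h1)
      calc ‖w x • fderiv ℝ ψ x + ψ x • fderiv ℝ w x‖
          ≤ ‖w x‖ * ‖fderiv ℝ ψ x‖ + ‖ψ x‖ * ‖fderiv ℝ w x‖ := by
            refine (norm_add_le _ _).trans ?_
            rw [norm_smul, norm_smul]
        _ ≤ 1 * T + P * (Cw * (b.2 : ℝ)⁻¹) := by
            gcongr
            · rw [Real.norm_of_nonneg (hw0 x)]; exact hw1 x
            · exact hT x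
            · exact hP x
        _ ≤ T * (b.2 : ℝ)⁻¹ + P * (Cw * (b.2 : ℝ)⁻¹) := by
            rw [one_mul]
            gcongr
            exact le_mul_of_one_le_right hT0 hb1
        _ = (T + P * Cw) * (b.2 : ℝ)⁻¹ := by ring
        _ ≤ ((κ * (b.2)⁻¹ : ℝ≥0) : ℝ) := by push_cast; gcongr
  refine ⟨v, ⟨hvsm, hψ.compact_support.of_isClosed_subset (isClosed_tsupport _) hvψ, ?_⟩, ?_, ?_⟩
  · refine fun x hx => ⟨hψ.support_subset (hvψ hx), fun hxE => ?_⟩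
    have hxK : x ∈ F ∩ tsupport ψ := ⟨(hEF ▸ hxE).1, hvψ hx⟩
    have hopen : IsOpen (⋃ b ∈ t, Metric.ball b.1 (b.2 : ℝ)) :=
      isOpen_biUnion fun _ _ => Metric.isOpen_ball
    -- Vanishing on an open set passes to the closed support, so v vanishes near F ∩ supp ψ.
    have hsub : tsupport v ⊆ (⋃ b ∈ t, Metric.ball b.1 (b.2 : ℝ))ᶜ := by
      refine closure_minimal (fun y hy hy' => hy ?_) hopen.isClosed_compl
      obtain ⟨b, hb, hyb⟩ := Set.mem_iUnion₂.1 hy'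
      simp only [hv, hwB b hb y hyb, one_mul, sub_self]
    exact hsub hx (htcov hxK)
  · intro x hx
    refine (hpt x).resolve_right ?_
    rintro ⟨b, hb, hxb, -⟩
    obtain ⟨y, hyb, hyK⟩ := htK b hb
    refine hx (Metric.mem_cthickening_of_dist_le x y _ _ hyK ?_)
    rw [Metric.mem_ball] at hxb hyb
    have h1 : b.2 ≤ r / 4 := (hδle b hb).trans (min_le_left _ _)
    have h2 : (b.2 : ℝ) ≤ r / 4 := by exact_mod_cast h1
    push_cast at hxb
    linarith [dist_triangle_right x y b.1]
  · calc modular φ Ω (fun x => gradient ψ x - gradient v x)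
        ≤ ∫⁻ x in Ω, ((L * κ ^ q : ℝ≥0) : ℝ≥0∞) *
          ∑ b ∈ t, (Metric.ball b.1 ((3 * b.2 : ℝ≥0) : ℝ)).indicator (fun x => φ x (b.2)⁻¹) x := by
          refine lintegral_mono_ae ?_
          filter_upwards [hL, hφ.monotone, hφ.zero] with x hx hm h0
          rcases hpt x with h | ⟨b, hb, hxb, hle⟩
          · simp [h, h0]
          · refine (hm hle).trans ((hx κ _ hκ1).trans ?_)
            gcongr
            refine le_trans (le_of_eq ?_) (Finset.single_le_sum (fun _ _ => zero_le) hb)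
            rw [Set.indicator_of_mem hxb]
      _ = ((L * κ ^ q : ℝ≥0) : ℝ≥0∞) * ∫⁻ x in Ω, ∑ b ∈ t,
          (Metric.ball b.1 ((3 * b.2 : ℝ≥0) : ℝ)).indicator (fun x => φ x (b.2)⁻¹) x :=
          lintegral_const_mul' _ _ ENNReal.coe_ne_top
      _ ≤ ((L * κ ^ q : ℝ≥0) : ℝ≥0∞) * (Cd * M) := by
          gcongr
          refine lintegral_sum_balls_le hφ (fun b hb => hCd b (hS.radius_pos b hb) ?_
            (hS.subset b hb)) hSM.le htS
          exact (hS.radius_le b hb).trans ((min_le_right _ _).trans (min_le_left _ _))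
      _ = _ := by push_cast; ring

end

section

/-! ### Removability -/

variable {Ω : Set (Euc n)} {φ : Euc n → ℝ≥0 → ℝ≥0∞}

theorem enorm_inner_le_mul (y z : Euc n) : ‖⟪y, z⟫‖ₑ ≤ ‖y‖ₑ * ‖z‖ₑ := by
  rw [enorm_eq_nnnorm, enorm_eq_nnnorm, enorm_eq_nnnorm, ← ENNReal.coe_mul]
  exact ENNReal.coe_le_coe.2 (nnnorm_inner_le_nnnorm (𝕜 := ℝ) y z)

theorem enorm_setIntegral_inner_le (U : Set (Euc n)) (f Z : Euc n → Euc n) :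
    ‖∫ x in U, ⟪f x, Z x⟫‖ₑ ≤ ∫⁻ x in U, ‖f x‖ₑ * ‖Z x‖ₑ := by
  refine (enorm_integral_le_lintegral_enorm _).trans (lintegral_mono fun x => ?_)
  exact enorm_inner_le_mul (f x) (Z x)

theorem modular_congr_ae {F : Type*} [NormedAddCommGroup F] {U : Set (Euc n)} {f g : Euc n → F}
    (h : f =ᵐ[volume.restrict U] g) : modular φ U f = modular φ U g :=
  lintegral_congr_ae (h.mono fun x hx => by simp only [hx])

/-- Additivity of the lower integral needs only one measurable summand, so Z may be arbitrary. -/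
theorem lintegral_mul_le_modular (hφ : IsConvexPhi Ω φ) {f g Z : Euc n → Euc n}
    (hg : AEStronglyMeasurable g (volume.restrict Ω)) {a b : ℝ≥0}
    (h : ∀ᵐ x ∂volume.restrict Ω, ∀ ζ : Euc n,
      ‖f x‖ₑ * ‖ζ‖ₑ ≤ a * φ x ‖g x‖₊ + b * φ x ‖ζ‖₊) :
    ∫⁻ x in Ω, ‖f x‖ₑ * ‖Z x‖ₑ ≤ a * modular φ Ω g + b * modular φ Ω Z := by
  have hm : AEMeasurable (fun x => φ x ‖g x‖₊) (volume.restrict Ω) :=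
    hφ.aemeasurable_apply Measure.AbsolutelyContinuous.rfl hg.nnnorm.aemeasurable
  calc ∫⁻ x in Ω, ‖f x‖ₑ * ‖Z x‖ₑ
      ≤ ∫⁻ x in Ω, (a * φ x ‖g x‖₊ + b * φ x ‖Z x‖₊) :=
        lintegral_mono_ae (h.mono fun x hx => hx (Z x))
    _ = a * modular φ Ω g + b * modular φ Ω Z := by
        rw [lintegral_add_left' (hm.const_mul _), lintegral_const_mul' _ _ ENNReal.coe_ne_top,
          lintegral_const_mul' _ _ ENNReal.coe_ne_top, modular, modular]

theorem integrableOn_inner_of_modular_lt_top (hφ : IsConvexPhi Ω φ) {f g Z : Euc n → Euc n}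
    (hf : AEStronglyMeasurable f (volume.restrict Ω))
    (hg : AEStronglyMeasurable g (volume.restrict Ω)) (hgm : modular φ Ω g < ⊤) {a b : ℝ≥0}
    (h : ∀ᵐ x ∂volume.restrict Ω, ∀ ζ : Euc n,
      ‖f x‖ₑ * ‖ζ‖ₑ ≤ a * φ x ‖g x‖₊ + b * φ x ‖ζ‖₊)
    (hZ : AEStronglyMeasurable Z (volume.restrict Ω)) (hZm : modular φ Ω Z < ⊤) :
    IntegrableOn (fun x => ⟪f x, Z x⟫) Ω := by
  refine ⟨hf.inner hZ, lt_of_le_of_lt (lintegral_mono fun x => ?_)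
    ((lintegral_mul_le_modular hφ hg h (Z := Z)).trans_lt ?_)⟩
  · exact enorm_inner_le_mul (f x) (Z x)
  · exact ENNReal.add_lt_top.2 ⟨ENNReal.mul_lt_top ENNReal.coe_lt_top hgm,
      ENNReal.mul_lt_top ENNReal.coe_lt_top hZm⟩

theorem eq_zero_of_forall_enorm_le {X : ℝ} {C : ℝ≥0} {p : ℝ} (hp : 1 < p)
    (h : ∀ K : ℝ≥0, 1 ≤ K → ‖X‖ₑ ≤ ((C * (K ^ (p - 1))⁻¹ : ℝ≥0) : ℝ≥0∞)) : X = 0 := by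
  have hp' : p - 1 ≠ 0 := (sub_pos.2 hp).ne'
  have key : ∀ m : ℕ, |X| ≤ C * (1 / ((m : ℝ) + 1)) := by
    intro m
    -- K is chosen so that K^(p-1) = m + 1.
    have h1 : (1 : ℝ≥0) ≤ ((m : ℝ≥0) + 1) ^ (p - 1)⁻¹ :=
      NNReal.one_le_rpow (by simp) (inv_nonneg.2 (sub_pos.2 hp).le)
    have h2 := h _ h1
    rw [NNReal.rpow_inv_rpow hp', enorm_eq_nnnorm, ENNReal.coe_le_coe, ← NNReal.coe_le_coe] at h2
    simpa using h2
  have hlim : Tendsto (fun m : ℕ => (C : ℝ) * (1 / ((m : ℝ) + 1))) atTop (𝓝 (C * 0)) :=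
    tendsto_one_div_add_atTop_nhds_zero_nat.const_mul _
  rw [mul_zero] at hlim
  exact abs_eq_zero.1 (le_antisymm (ge_of_tendsto' hlim key) (abs_nonneg _))

/-- A field that annihilates all test functions supported away from `E` annihilates all test
functions of `Ω`, if `E` has finite intrinsic Hausdorff measure. -/
theorem setIntegral_inner_gradient_eq_zero (hn : n ≠ 0) (hΩ : IsOpen Ω)
    (hΩb : Bornology.IsBounded Ω) (hφ : IsConvexPhi Ω φ)
    (hA0 : CondA0 Ω φ) (hA1 : CondA1 Ω φ) {p q : ℝ} (hp : 1 < p) (hqn : q ≤ n)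
    (hdec : CondADec Ω φ q) {E F : Set (Euc n)} (hF : IsClosed F) (hEF : E = F ∩ Ω)
    (hE : hausdorffPhi φ Ω E < ⊤) {f g : Euc n → Euc n}
    (hf : AEStronglyMeasurable f (volume.restrict Ω))
    (hg : AEStronglyMeasurable g (volume.restrict Ω)) (hgm : modular φ Ω g < ⊤) {a b : ℝ≥0}
    (h : ∀ᵐ x ∂volume.restrict Ω, ∀ K : ℝ≥0, 1 ≤ K → ∀ ζ : Euc n,
      ‖f x‖ₑ * ‖ζ‖ₑ ≤ (a * K : ℝ≥0) * φ x ‖g x‖₊ +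
        ((b * (K ^ (p - 1))⁻¹ : ℝ≥0) : ℝ≥0∞) * φ x ‖ζ‖₊)
    (hsol : ∀ v : Euc n → ℝ, IsTestFunction (Ω \ E) v →
      ∫ x in Ω \ E, ⟪f x, gradient v x⟫ = 0)
    {ψ : Euc n → ℝ} (hψ : IsTestFunction Ω ψ) : ∫ x in Ω, ⟪f x, gradient ψ x⟫ = 0 := by
  have hE0 := volume_eq_zero_of_hausdorffPhi_lt_top hφ hA0 hE
  obtain ⟨C, hC⟩ := exists_isTestFunction_diff hn hΩ hφ hA0 hA1 hqn hdec hF hEF hE hψ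
  have hint : ∀ v : Euc n → ℝ, IsTestFunction Ω v →
      IntegrableOn (fun x => ⟪f x, gradient v x⟫) Ω := by
    intro v hv
    obtain ⟨T, hT⟩ := hv.hasCompactSupport_gradient.exists_bound_of_continuous
      (continuous_gradient hv.smooth)
    exact integrableOn_inner_of_modular_lt_top hφ hf hg hgm (h.mono fun x hx => hx 1 le_rfl)
      (continuous_gradient hv.smooth).aestronglyMeasurable
      (modular_lt_top_of_bounded hΩ.measurableSet hΩb hφ hA0 hdec subset_rfl (S := T.toNNReal)
        fun x => NNReal.le_toNNReal_of_coe_le (hT x))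
  set K₀ := F ∩ tsupport ψ with hK₀
  have hK₀c : IsCompact K₀ := hψ.compact_support.inter_left hF
  set ν : Measure (Euc n) := (volume.restrict Ω).withDensity fun x => φ x ‖g x‖₊ with hν
  have hνfin : ν Set.univ < ⊤ := by
    rw [hν, withDensity_apply _ MeasurableSet.univ, Measure.restrict_univ]; exact hgm
  have hν0 : ν K₀ = 0 := by
    refine withDensity_absolutelyContinuous _ _ (Measure.restrict_le_self.absolutelyContinuous ?_)
    exact measure_mono_null (hEF ▸ Set.inter_subset_inter_right _ hψ.support_subset) hE0
  have hνlim : Tendsto (fun r : ℝ => ν (Metric.cthickening r K₀)) (𝓝 0) (𝓝 0) := by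
    rw [← hν0]
    exact tendsto_measure_cthickening_of_isClosed
      ⟨1, one_pos, ((measure_mono (Set.subset_univ _)).trans_lt hνfin).ne⟩ hK₀c.isClosed
  -- K is frozen while r → 0, since its power multiplies the ν-term; only afterwards does K → ∞.
  refine eq_zero_of_forall_enorm_le (C := b * C) hp fun K hK => ?_
  have hbound : ∀ r : ℝ, 0 < r → ‖∫ x in Ω, ⟪f x, gradient ψ x⟫‖ₑ ≤
      ((a * K : ℝ≥0) : ℝ≥0∞) * ν (Metric.cthickening r K₀) +
        ((b * C * (K ^ (p - 1))⁻¹ : ℝ≥0) : ℝ≥0∞) := by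
    intro r hr
    obtain ⟨v, hv, hv0, hvC⟩ := hC ⟨r, hr.le⟩ hr
    have hvΩ : IsTestFunction Ω v := hv.mono Set.sdiff_subset
    have hvz : ∫ x in Ω, ⟪f x, gradient v x⟫ = 0 := by
      rw [← hsol v hv]
      exact setIntegral_congr_set (sdiff_null_ae_eq_self hE0).symm
    have heq : ∫ x in Ω, ⟪f x, gradient ψ x⟫ = ∫ x in Ω, ⟪f x, gradient ψ x - gradient v x⟫ := by
      simp only [inner_sub_right]
      rw [integral_sub (hint ψ hψ) (hint v hvΩ), hvz, sub_zero]
    have hN : MeasurableSet (Metric.cthickening r K₀) := Metric.isClosed_cthickening.measurableSet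
    have hm : AEMeasurable (fun x => φ x ‖g x‖₊) (volume.restrict Ω) :=
      hφ.aemeasurable_apply Measure.AbsolutelyContinuous.rfl hg.nnnorm.aemeasurable
    rw [heq]
    calc _ ≤ ∫⁻ x in Ω, ‖f x‖ₑ * ‖gradient ψ x - gradient v x‖ₑ := enorm_setIntegral_inner_le _ _ _
      _ ≤ ∫⁻ x in Ω, (((a * K : ℝ≥0) : ℝ≥0∞) *
            (Metric.cthickening r K₀).indicator (fun x => φ x ‖g x‖₊) x +
          ((b * (K ^ (p - 1))⁻¹ : ℝ≥0) : ℝ≥0∞) * φ x ‖gradient ψ x - gradient v x‖₊) := by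
          refine lintegral_mono_ae (h.mono fun x hx => ?_)
          by_cases hxN : x ∈ Metric.cthickening r K₀
          · rw [Set.indicator_of_mem hxN]
            exact hx K hK _
          · rw [hv0 x hxN]
            simp
      _ = ((a * K : ℝ≥0) : ℝ≥0∞) * ν (Metric.cthickening r K₀) +
          ((b * (K ^ (p - 1))⁻¹ : ℝ≥0) : ℝ≥0∞) *
            modular φ Ω (fun x => gradient ψ x - gradient v x) := by
          rw [lintegral_add_left' ((hm.indicator hN).const_mul _),
            lintegral_const_mul' _ _ ENNReal.coe_ne_top,
            lintegral_const_mul' _ _ ENNReal.coe_ne_top, lintegral_indicator hN, hν,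
            withDensity_apply _ hN, modular]
      _ ≤ ((a * K : ℝ≥0) : ℝ≥0∞) * ν (Metric.cthickening r K₀) +
          ((b * (K ^ (p - 1))⁻¹ : ℝ≥0) : ℝ≥0∞) * C := by gcongr
      _ = _ := by push_cast; ring
  have hlim : Tendsto (fun r : ℝ => ((a * K : ℝ≥0) : ℝ≥0∞) * ν (Metric.cthickening r K₀) +
        ((b * C * (K ^ (p - 1))⁻¹ : ℝ≥0) : ℝ≥0∞)) (𝓝[>] 0)
      (𝓝 (((a * K : ℝ≥0) : ℝ≥0∞) * 0 + ((b * C * (K ^ (p - 1))⁻¹ : ℝ≥0) : ℝ≥0∞))) :=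
    (ENNReal.Tendsto.const_mul (hνlim.mono_left nhdsWithin_le_nhds)
      (Or.inr ENNReal.coe_ne_top)).add tendsto_const_nhds
  rw [mul_zero, zero_add] at hlim
  refine ge_of_tendsto hlim ?_
  filter_upwards [self_mem_nhdsWithin] with r hr using hbound r hr

/-- Density: a field of `φ`-growth annihilating the gradients of test functions annihilates the
gradients of `W_0^{1,φ(·)}`. -/
theorem setIntegral_inner_eq_zero_of_luxNorm (hφ : IsConvexPhi Ω φ) {f g Z : Euc n → Euc n}
    (hg : AEStronglyMeasurable g (volume.restrict Ω)) (hgm : modular φ Ω g < ⊤) {a b : ℝ≥0}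
    (h : ∀ᵐ x ∂volume.restrict Ω, ∀ ζ : Euc n,
      ‖f x‖ₑ * ‖ζ‖ₑ ≤ a * φ x ‖g x‖₊ + b * φ x ‖ζ‖₊)
    (hZ : IntegrableOn (fun x => ⟪f x, Z x⟫) Ω)
    (happ : ∀ ε : ℝ≥0∞, 0 < ε → ∃ G : Euc n → Euc n, IntegrableOn (fun x => ⟪f x, G x⟫) Ω ∧
      ∫ x in Ω, ⟪f x, G x⟫ = 0 ∧ luxNorm φ Ω (fun x => Z x - G x) < ε) :
    ∫ x in Ω, ⟪f x, Z x⟫ = 0 := by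
  lift modular φ Ω g to ℝ≥0 using hgm.ne with M hM
  have key : ∀ ε : ℝ≥0, 0 < ε →
      ‖∫ x in Ω, ⟪f x, Z x⟫‖ₑ ≤ ((ε * (a * M + b) : ℝ≥0) : ℝ≥0∞) := by
    intro ε hε
    obtain ⟨G, hGi, hG0, hG⟩ := happ ε (by exact_mod_cast hε)
    simp only [luxNorm, iInf_lt_iff] at hG
    obtain ⟨t, ⟨ht0, ht1⟩, htε⟩ := hG
    have heq : ∫ x in Ω, ⟪f x, Z x⟫ = ∫ x in Ω, ⟪f x, Z x - G x⟫ := by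
      simp only [inner_sub_right]
      rw [integral_sub hZ hGi, hG0, sub_zero]
    -- Rescaling by an admissible t < ε in the Luxemburg norm makes the modular at most 1, so the
    -- integral is at most t(aM + b).
    have hscale : ∀ x, ‖f x‖ₑ * ‖Z x - G x‖ₑ =
        t * (‖f x‖ₑ * ‖(t : ℝ)⁻¹ • (Z x - G x)‖ₑ) := by
      intro x
      have ht : (t : ℝ) ≠ 0 := NNReal.coe_ne_zero.2 ht0.ne'
      have h1 : Z x - G x = (t : ℝ) • ((t : ℝ)⁻¹ • (Z x - G x)) := by
        rw [smul_smul, mul_inv_cancel₀ ht, one_smul]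
      have h2 : ‖(t : ℝ)‖ₑ = t := by
        rw [enorm_eq_nnnorm, NNReal.nnnorm_eq]
      nth_rewrite 1 [h1]
      rw [enorm_smul, h2]
      ring
    have hmod : modular φ Ω (fun x => (t : ℝ)⁻¹ • (Z x - G x)) ≤ 1 := by
      refine le_trans (le_of_eq ?_) ht1
      simp only [modular, nnnorm_smul, nnnorm_inv, NNReal.nnnorm_eq, div_eq_inv_mul]
    rw [heq]
    calc _ ≤ ∫⁻ x in Ω, ‖f x‖ₑ * ‖Z x - G x‖ₑ := enorm_setIntegral_inner_le _ _ _
      _ = t * ∫⁻ x in Ω, ‖f x‖ₑ * ‖(t : ℝ)⁻¹ • (Z x - G x)‖ₑ := by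
          simp only [hscale]
          rw [lintegral_const_mul' _ _ ENNReal.coe_ne_top]
      _ ≤ t * (a * modular φ Ω g + b * modular φ Ω (fun x => (t : ℝ)⁻¹ • (Z x - G x))) := by
          gcongr
          exact lintegral_mul_le_modular hφ hg h
      _ ≤ ε * (a * M + b * 1) := by
          rw [hM]
          gcongr
      _ = _ := by push_cast; ring
  have hlim : Tendsto (fun ε : ℝ≥0 => ((ε * (a * M + b) : ℝ≥0) : ℝ≥0∞)) (𝓝[>] 0) (𝓝 0) := by
    have : Tendsto (fun ε : ℝ≥0 => ((ε * (a * M + b) : ℝ≥0) : ℝ≥0∞)) (𝓝 0)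
        (𝓝 ((0 * (a * M + b) : ℝ≥0) : ℝ≥0∞)) :=
      (ENNReal.continuous_coe.comp
        (by fun_prop : Continuous fun ε : ℝ≥0 => ε * (a * M + b))).tendsto 0
    simpa using this.mono_left nhdsWithin_le_nhds
  have := ge_of_tendsto hlim (by filter_upwards [self_mem_nhdsWithin] with ε hε using key ε hε)
  exact enorm_eq_zero.1 (le_antisymm this zero_le)

end

end MusielakOrlicz

/-! ### Passage from test functions to the whole zero-trace space -/

theorem corollary3p3 (n : ℕ) (hn : 2 ≤ n)
    (Ω : Set (MusielakOrlicz.Euc n)) (hΩ : IsOpen Ω) (hΩb : Bornology.IsBounded Ω)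
    (φ : MusielakOrlicz.Euc n → ℝ≥0 → ℝ≥0∞) (hφ : MusielakOrlicz.IsConvexPhi Ω φ)
    (hA0 : MusielakOrlicz.CondA0 Ω φ) (hA1 : MusielakOrlicz.CondA1 Ω φ)
    (p q : ℝ) (hp : 1 < p) (hpq : p ≤ q) (hqn : q ≤ n)
    (hinc : MusielakOrlicz.CondAInc Ω φ p) (hdec : MusielakOrlicz.CondADec Ω φ q)
    (A : MusielakOrlicz.Euc n → MusielakOrlicz.Euc n → MusielakOrlicz.Euc n)
    (hA : MusielakOrlicz.IsAdmissibleField Ω φ A)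
    (E : Set (MusielakOrlicz.Euc n)) (hEΩ : E ⊆ Ω)
    (hE : ∃ F : Set (MusielakOrlicz.Euc n), IsClosed F ∧ E = F ∩ Ω)
    (hHE : MusielakOrlicz.hausdorffPhi φ Ω E < ⊤)
    (u : MusielakOrlicz.Euc n → ℝ) (Du : MusielakOrlicz.Euc n → MusielakOrlicz.Euc n)
    (hu : MusielakOrlicz.MemW1 φ Ω u) (hDu : MusielakOrlicz.HasWeakGradient Ω u Du)
    (hsol : ∀ (w : MusielakOrlicz.Euc n → ℝ) (Dw : MusielakOrlicz.Euc n → MusielakOrlicz.Euc n),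
      MusielakOrlicz.MemW10 φ (Ω \ E) w → MusielakOrlicz.HasWeakGradient (Ω \ E) w Dw →
        ∫ x in Ω \ E, ⟪A x (Du x), Dw x⟫ = 0) :
    MusielakOrlicz.IsSolution φ A Ω u := by
  have hn0 : n ≠ 0 := by omega
  obtain ⟨F, hF, hEF⟩ := hE
  obtain ⟨c, L, hY⟩ := hA.young hn0 hφ hp hinc
  refine ⟨hu, fun Du' hDu' w Dw hw hDw => ?_⟩
  have hDD : Du' =ᵐ[volume.restrict Ω] Du := hDu'.ae_eq hΩ hDu
  have hg : AEStronglyMeasurable Du (volume.restrict Ω) :=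
    hDu.locallyIntegrable_grad.aestronglyMeasurable
  have hgm : MusielakOrlicz.modular φ Ω Du < ⊤ := by
    obtain ⟨D, hD, -, -, -, hDm⟩ := hu
    rwa [MusielakOrlicz.modular_congr_ae (hDu.ae_eq hΩ hD)]
  have hf : AEStronglyMeasurable (fun x => A x (Du x)) (volume.restrict Ω) :=
    (MusielakOrlicz.aemeasurable_apply_of_continuous hA.measurable hA.continuous
      hg.aemeasurable).aestronglyMeasurable
  have hY' : ∀ᵐ x ∂volume.restrict Ω, ∀ K : ℝ≥0, 1 ≤ K → ∀ ζ : MusielakOrlicz.Euc n,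
      ‖A x (Du x)‖ₑ * ‖ζ‖ₑ ≤ (c * K : ℝ≥0) * φ x ‖Du x‖₊ +
        ((L * (K ^ (p - 1))⁻¹ : ℝ≥0) : ℝ≥0∞) * φ x ‖ζ‖₊ :=
    hY.mono fun x hx K hK ζ => hx K hK (Du x) ζ
  have hY1 := hY'.mono fun x hx => hx 1 le_rfl
  have htest : ∀ ψ : MusielakOrlicz.Euc n → ℝ, MusielakOrlicz.IsTestFunction Ω ψ →
      ∫ x in Ω, ⟪A x (Du x), gradient ψ x⟫ = 0 := fun ψ hψ =>
    MusielakOrlicz.setIntegral_inner_gradient_eq_zero hn0 hΩ hΩb hφ hA0 hA1 hp hqn hdec hF hEF hHE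
      hf hg hgm hY' (fun v hv => hsol v (gradient v)
        (hv.memW10 hΩ.measurableSet hΩb hφ hA0 hdec Set.sdiff_subset) hv.hasWeakGradient) hψ
  have hint : ∀ (v : MusielakOrlicz.Euc n → ℝ) (Dv : MusielakOrlicz.Euc n → MusielakOrlicz.Euc n),
      MusielakOrlicz.MemW1 φ Ω v → MusielakOrlicz.HasWeakGradient Ω v Dv →
      IntegrableOn (fun x => ⟪A x (Du x), Dv x⟫) Ω := by
    rintro v Dv ⟨D, hD, -, -, -, hDm⟩ hDv
    exact MusielakOrlicz.integrableOn_inner_of_modular_lt_top hφ hf hg hgm hY1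
      hDv.locallyIntegrable_grad.aestronglyMeasurable
      (by rwa [MusielakOrlicz.modular_congr_ae (hDv.ae_eq hΩ hD)])
  have hcongr : (fun x => ⟪A x (Du' x), Dw x⟫) =ᵐ[volume.restrict Ω]
      fun x => ⟪A x (Du x), Dw x⟫ := hDD.mono fun x hx => by simp only [hx]
  rw [integral_congr_ae hcongr]
  refine ⟨(hint w Dw hw.1 hDw).congr hcongr.symm, ?_⟩
  obtain ⟨hw1, Dw₂, hDw₂, happ⟩ := hw
  -- The approximation in `MemW10` concerns its own gradient `Dw₂`, which agrees almost everywhere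
  -- with the given one.
  rw [integral_congr_ae (g := fun x => ⟪A x (Du x), Dw₂ x⟫)
    ((hDw.ae_eq hΩ hDw₂).mono fun x hx => by simp only [hx])]
  refine MusielakOrlicz.setIntegral_inner_eq_zero_of_luxNorm hφ hg hgm hY1 (hint w Dw₂ hw1 hDw₂)
    fun ε hε => ?_
  obtain ⟨ψ, hψ, hψε⟩ := happ ε hε
  exact ⟨gradient ψ, hint ψ (gradient ψ)
    (hψ.memW10 hΩ.measurableSet hΩb hφ hA0 hdec subset_rfl).1 hψ.hasWeakGradient, htest ψ hψ,
    le_add_self.trans_lt hψε⟩
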